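/- **Conventions.** A *locally $C^*$-algebra* is a complete Hausdorff complex topological $*$-algebra $A$ (not necessarily unital) such that a net $(a_i)$ converges to $0$ in $A$ if and only if $p(a_i)\to 0$ for every $p\in S(A)$, where $S(A)$ is the set of continuous $C^*$-seminorms on $A$. $\mathrm{Aut}(A)$ is the group of $*$-automorphisms of $A$ that are continuous together with their inverses. A *Hilbert $A$-module* is a complex vector space $E$ with a compatible right $A$-action and an $A$-valued inner product $\langle\cdot,\cdot\rangle$, $\mathbb C$- and $A$-linear in the second variable, with $\langle\xi,\eta\rangle^*=\langle\eta,\xi\rangle$, $\langle\xi,\xi\rangle\ge 0$, and $\langle\xi,\xi\rangle=0$ only for $\xi=0$, complete for the seminorms $\overline p_E(\xi)=p(\langle\xi,\xi\rangle)^{1/2}$, $p\in S(A)$. It is *full* if the linear span of $\{\langle\xi,\eta\rangle:\xi,\eta\in E\}$ is dense in $A$. $L(E)$ is the $*$-algebra of adjointable module morphisms $E\to E$, with the topology of the seminorms $\widetilde p(T)=\sup\{\overline p_E(T\xi):\overline p_E(\xi)\le 1\}$, $p\in S(A)$, and $K(E)$ is the closure in $L(E)$ of the linear span of the operators $\theta_{\xi,\eta}(\zeta)=\xi\langle\eta,\zeta\rangle$.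 $\mathrm{Aut}(E)$ is the group of bijections $u:E\to E$ such that for each $v\in\{u,u^{-1}\}$ there is a continuous $*$-homomorphism $\alpha:A\to A$ with $\langle v\xi,v\eta\rangle=\alpha(\langle\xi,\eta\rangle)$ for all $\xi,\eta\in E$. Let $G$ be a locally compact group. An *action* of $G$ on $A$ (on $K(E)$, on $E$) is a group homomorphism from $G$ to $\mathrm{Aut}(A)$ ($\mathrm{Aut}(K(E))$, $\mathrm{Aut}(E)$); it is *continuous* if $g\mapsto \alpha_g(a)$ (respectively $g\mapsto u_g(\xi)$) is continuous for each $a$ (respectively $\xi$). An action on a locally $C^*$-algebra $A$ is an *inverse limit action* if $A$ can be written as an inverse limit $\varprojlim_{\lambda} A_\lambda$ of $C^*$-algebras over a directed set so that $\alpha_g=\varprojlim_\lambda\alpha^\lambda_g$ for all $g\in G$, for actions $\alpha^\lambda$ of $G$ on $A_\lambda$. An action $u$ on $E$ is an *inverse limit action* if $E$ can be written as an inverse limit $\varprojlim_\lambda E_\lambda$ of Hilbert $C^*$-modules $E_\lambda$ over $C^*$-algebras $A_\lambda$ with $A=\varprojlim_\lambda A_\lambda$, over a directed set, so that $u_g=\varprojlim_\lambda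 u^\lambda_g$ for all $g\in G$, for actions $u^\lambda$ of $G$ on $E_\lambda$. A *continuous inverse limit action* is a continuous action that is an inverse limit action; for an action $\alpha$ on a locally $C^*$-algebra $A$ it is moreover required that the $p\in S(A)$ with $p\circ\alpha_g=p$ for all $g\in G$ be cofinal in $S(A)$. **Proposition.** Let $G$ be a locally compact group, $A$ a locally $C^*$-algebra, $E$ a full Hilbert $A$-module, and $g\mapsto u_g$ an action of $G$ on $E$. 1. There is a unique action $g\mapsto\alpha^u_g$ of $G$ on $A$ such that $\alpha^u_g(\langle\xi,\eta\rangle)=\langle u_g(\xi),u_g(\eta)\rangle$ for all $g\in G$ and $\xi,\eta\in E$. 2. There is a unique action $g\mapsto\beta^u_g$ of $G$ on $K(E)$ such that $\beta^u_g(\theta_{\xi,\eta})=\theta_{u_g(\xi),u_g(\eta)}$ for all $g\in G$ and $\xi,\eta\in E$. 3. If $u$ is a continuous inverse limit action of $G$ on $E$, then $\alpha^u$ and $\beta^u$ are continuous inverse limit actions of $G$ on $A$ and on $K(E)$ respectively. -/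

import Mathlib

open Filter Topology

universe w v x

noncomputable section

/-! ### Locally C⋆-algebras -/

/-- A continuous C⋆-seminorm on a complex topological ⋆-algebra. -/
structure ContCStarSeminorm (A : Type*) [NonUnitalRing A] [StarRing A] [Module ℂ A]
    [TopologicalSpace A] extends Seminorm ℂ A where
  mul_le' : ∀ a b : A, toFun (a * b) ≤ toFun a * toFun b
  star_mul_self' : ∀ a : A, toFun (star a * a) = toFun a ^ 2
  continuous' : Continuous toFun

namespace ContCStarSeminorm

variable {A : Type*} [NonUnitalRing A] [StarRing A] [Module ℂ A] [TopologicalSpace A]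

instance : FunLike (ContCStarSeminorm A) A ℝ where
  coe p := p.toFun
  coe_injective p q h := by
    rcases p with ⟨p, _, _, _⟩
    rcases q with ⟨q, _, _, _⟩
    congr
    exact DFunLike.coe_injective h

instance : SeminormClass (ContCStarSeminorm A) ℂ A where
  map_zero p := p.map_zero'
  map_add_le_add p := p.add_le'
  map_neg_eq_map p := p.neg'
  map_smul_eq_mul p := p.smul'

theorem mul_le (p : ContCStarSeminorm A) (a b : A) : p (a * b) ≤ p a * p b := p.mul_le' a b

theorem star_mul_self (p : ContCStarSeminorm A) (a : A) : p (star a * a) = p a ^ 2 :=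
  p.star_mul_self' a

theorem map_star (p : ContCStarSeminorm A) (a : A) : p (star a) = p a := by
  have key : ∀ b : A, p b ≤ p (star b) := fun b => by
    have h := p.mul_le (star b) b
    rw [p.star_mul_self] at h
    rcases (apply_nonneg p b).eq_or_lt with h0 | h0
    · rw [← h0]; exact apply_nonneg p _
    · nlinarith
  exact le_antisymm (by simpa using key (star a)) (key a)

end ContCStarSeminorm

/-- A locally C⋆-algebra: a complete Hausdorff complex topological ⋆-algebra (not necessarily
unital) in which a net tends to `0` iff all continuous C⋆-seminorms of it tend to `0`.
(Continuity of the multiplication and of the involution follows from the last condition.) -/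
class IsLocallyCStarAlgebra (A : Type*) [NonUnitalRing A] [StarRing A] [Module ℂ A]
    [UniformSpace A] : Prop extends IsScalarTower ℂ A A, SMulCommClass ℂ A A, StarModule ℂ A,
    IsUniformAddGroup A, CompleteSpace A, T2Space A where
  nhds_zero : 𝓝 (0 : A) = ⨅ p : ContCStarSeminorm A, comap p (𝓝 (0 : ℝ))

/-! ### The C⋆-algebra attached to a continuous C⋆-seminorm -/

namespace ContCStarSeminorm

section Completion

open UniformSpace

variable {A : Type*} [NonUnitalRing A] [StarRing A] [Module ℂ A] [TopologicalSpace A]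

/-- The algebra `A` regarded as seminormed by `p`. -/
def Pre (_p : ContCStarSeminorm A) : Type _ := A

variable (p : ContCStarSeminorm A)

instance : NonUnitalRing p.Pre := inferInstanceAs (NonUnitalRing A)
instance : StarRing p.Pre := inferInstanceAs (StarRing A)
instance : Module ℂ p.Pre := inferInstanceAs (Module ℂ A)
instance [IsScalarTower ℂ A A] : IsScalarTower ℂ p.Pre p.Pre :=
  inferInstanceAs (IsScalarTower ℂ A A)
instance [SMulCommClass ℂ A A] : SMulCommClass ℂ p.Pre p.Pre :=
  inferInstanceAs (SMulCommClass ℂ A A)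
instance [StarModule ℂ A] : StarModule ℂ p.Pre := inferInstanceAs (StarModule ℂ A)

instance : NonUnitalSeminormedRing p.Pre :=
  { (inferInstance : NonUnitalRing p.Pre),
    AddGroupSeminorm.toSeminormedAddCommGroup (E := p.Pre) p.toSeminorm.toAddGroupSeminorm with
    norm_mul_le := p.mul_le }

theorem norm_pre (a : p.Pre) : ‖a‖ = p a := rfl

instance : NormedSpace ℂ p.Pre where
  norm_smul_le c a := (map_smul_eq_mul p c a).le

instance : NormedStarGroup p.Pre where
  norm_star_le a := (p.map_star a).le

/-- The Hausdorff completion of `A` with respect to `p`. -/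
def Compl : Type _ := Completion p.Pre

instance : NormedAddCommGroup p.Compl := inferInstanceAs (NormedAddCommGroup (Completion p.Pre))
instance : NormedSpace ℂ p.Compl := inferInstanceAs (NormedSpace ℂ (Completion p.Pre))
instance : CompleteSpace p.Compl := inferInstanceAs (CompleteSpace (Completion p.Pre))

/-- The canonical map of `A` into its completion with respect to `p`. -/
def toCompl (a : A) : p.Compl := ((show p.Pre from a : p.Pre) : Completion p.Pre)

theorem norm_toCompl (a : A) : ‖p.toCompl a‖ = p a :=
  (Completion.norm_coe (E := p.Pre) a).trans (p.norm_pre a)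

theorem toCompl_add (a b : A) : p.toCompl (a + b) = p.toCompl a + p.toCompl b :=
  Completion.coe_add (α := p.Pre) a b

theorem toCompl_zero : p.toCompl 0 = 0 := rfl

theorem toCompl_smul (c : ℂ) (a : A) : p.toCompl (c • a) = c • p.toCompl a :=
  Completion.coe_smul (X := p.Pre) c a

theorem continuous_coe_pre : Continuous (fun a : p.Pre => p.toCompl a) :=
  Completion.continuous_coe p.Pre

theorem isDenseInducing_coe_pre : IsDenseInducing (fun a : p.Pre => p.toCompl a) :=
  Completion.isDenseInducing_coe

theorem denseRange_toCompl : DenseRange p.toCompl := p.isDenseInducing_coe_pre.dense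

instance : Mul p.Compl :=
  ⟨Function.curry <| (p.isDenseInducing_coe_pre.prodMap p.isDenseInducing_coe_pre).extend
    ((fun a : p.Pre => p.toCompl a) ∘ Function.uncurry (· * ·))⟩

theorem toCompl_mul (a b : A) : p.toCompl (a * b) = p.toCompl a * p.toCompl b :=
  ((p.isDenseInducing_coe_pre.prodMap p.isDenseInducing_coe_pre).extend_eq
    (p.continuous_coe_pre.comp (continuous_mul (M := p.Pre))) (a, b)).symm

instance : ContinuousMul p.Compl where
  continuous_mul := by
    let i : p.Pre →+ p.Compl := ⟨⟨fun a => p.toCompl a, p.toCompl_zero⟩, p.toCompl_add⟩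
    let m := (AddMonoidHom.mul : p.Pre →+ p.Pre →+ p.Pre).compr₂ i
    have : Continuous fun x : p.Pre × p.Pre => m x.1 x.2 :=
      p.continuous_coe_pre.comp continuous_mul
    have di : IsDenseInducing (i : p.Pre → p.Compl) := p.isDenseInducing_coe_pre
    exact (di.extend_Z_bilin di this :)

instance : Star p.Compl := ⟨Completion.map (fun a : p.Pre => star a)⟩

theorem toCompl_star (a : A) : p.toCompl (star a) = star (p.toCompl a) :=
  (Completion.map_coe (f := fun a : p.Pre => star a) (star_isometry (E := p.Pre)).uniformContinuous
    a).symm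

instance : ContinuousStar p.Compl :=
  ⟨Completion.continuous_map (f := fun a : p.Pre => star a)⟩

@[elab_as_elim]
theorem compl_induction {P : p.Compl → Prop} (x : p.Compl) (hP : IsClosed {x | P x})
    (h : ∀ a : A, P (p.toCompl a)) : P x :=
  p.denseRange_toCompl.induction_on x hP h

@[elab_as_elim]
theorem compl_induction₂ {P : p.Compl → p.Compl → Prop} (x y : p.Compl)
    (hP : IsClosed {x : p.Compl × p.Compl | P x.1 x.2})
    (h : ∀ a b : A, P (p.toCompl a) (p.toCompl b)) : P x y :=
  p.denseRange_toCompl.induction_on₂ hP h x y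

@[elab_as_elim]
theorem compl_induction₃ {P : p.Compl → p.Compl → p.Compl → Prop} (x y z : p.Compl)
    (hP : IsClosed {x : p.Compl × p.Compl × p.Compl | P x.1 x.2.1 x.2.2})
    (h : ∀ a b c : A, P (p.toCompl a) (p.toCompl b) (p.toCompl c)) : P x y z :=
  p.denseRange_toCompl.induction_on₃ hP h x y z

theorem compl_mul_assoc (x y z : p.Compl) : x * y * z = x * (y * z) :=
  p.compl_induction₃ x y z (isClosed_eq (by fun_prop) (by fun_prop))
    fun a b c => by simp only [← toCompl_mul, mul_assoc]

theorem compl_mul_add (x y z : p.Compl) : x * (y + z) = x * y + x * z :=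
  p.compl_induction₃ x y z (isClosed_eq (by fun_prop) (by fun_prop))
    fun a b c => by simp only [← toCompl_mul, ← toCompl_add, mul_add]

theorem compl_add_mul (x y z : p.Compl) : (x + y) * z = x * z + y * z :=
  p.compl_induction₃ x y z (isClosed_eq (by fun_prop) (by fun_prop))
    fun a b c => by simp only [← toCompl_mul, ← toCompl_add, add_mul]

theorem compl_norm_mul_le (x y : p.Compl) : ‖x * y‖ ≤ ‖x‖ * ‖y‖ :=
  p.compl_induction₂ x y (isClosed_le (by fun_prop) (by fun_prop))
    fun a b => by simpa only [← toCompl_mul, norm_toCompl] using p.mul_le a b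

theorem compl_star_star (x : p.Compl) : star (star x) = x :=
  p.compl_induction x (isClosed_eq (by fun_prop) (by fun_prop))
    fun a => by simp only [← toCompl_star, star_star]

theorem compl_star_mul (x y : p.Compl) : star (x * y) = star y * star x :=
  p.compl_induction₂ x y (isClosed_eq (by fun_prop) (by fun_prop))
    fun a b => by simp only [← toCompl_star, ← toCompl_mul, star_mul]

theorem compl_star_add (x y : p.Compl) : star (x + y) = star x + star y :=
  p.compl_induction₂ x y (isClosed_eq (by fun_prop) (by fun_prop))
    fun a b => by simp only [← toCompl_star, ← toCompl_add, star_add]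

theorem compl_norm_mul_self_le (x : p.Compl) : ‖x‖ * ‖x‖ ≤ ‖star x * x‖ :=
  p.compl_induction x (isClosed_le (by fun_prop) (by fun_prop))
    fun a => by
      rw [← toCompl_star, ← toCompl_mul, norm_toCompl, norm_toCompl, p.star_mul_self, sq]

theorem compl_continuous_smul (c : ℂ) : Continuous fun x : p.Compl => c • x :=
  continuous_const_smul (T := Completion p.Pre) c

theorem compl_smul_mul [IsScalarTower ℂ A A] (c : ℂ) (x y : p.Compl) :
    (c • x) * y = c • (x * y) :=
  p.compl_induction₂ x y
    (isClosed_eq (((p.compl_continuous_smul c).comp continuous_fst).mul continuous_snd)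
      ((p.compl_continuous_smul c).comp continuous_mul))
    fun a b => by rw [← toCompl_mul, ← toCompl_smul, ← toCompl_smul, ← toCompl_mul, smul_mul_assoc]

theorem compl_mul_smul [SMulCommClass ℂ A A] (c : ℂ) (x y : p.Compl) :
    x * (c • y) = c • (x * y) :=
  p.compl_induction₂ x y
    (isClosed_eq (continuous_fst.mul ((p.compl_continuous_smul c).comp continuous_snd))
      ((p.compl_continuous_smul c).comp continuous_mul))
    fun a b => by rw [← toCompl_mul, ← toCompl_smul, ← toCompl_smul, ← toCompl_mul, mul_smul_comm]

theorem compl_star_smul [StarModule ℂ A] (c : ℂ) (x : p.Compl) : star (c • x) = star c • star x :=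
  p.compl_induction x
    (isClosed_eq (continuous_star.comp (p.compl_continuous_smul c))
      ((p.compl_continuous_smul (star c)).comp continuous_star))
    fun a => by rw [← toCompl_smul, ← toCompl_star, ← toCompl_star, ← toCompl_smul, star_smul]

/-- The completion of `A` with respect to a continuous C⋆-seminorm is a C⋆-algebra. -/
instance [IsScalarTower ℂ A A] [SMulCommClass ℂ A A] [StarModule ℂ A] :
    NonUnitalCStarAlgebra p.Compl where
  __ := (inferInstance : NormedAddCommGroup p.Compl)
  __ := (inferInstance : NormedSpace ℂ p.Compl)
  __ := (inferInstance : CompleteSpace p.Compl)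
  __ := (inferInstance : Mul p.Compl)
  __ := (inferInstance : Star p.Compl)
  zero_mul x := by simpa using p.compl_add_mul 0 0 x
  mul_zero x := by simpa using p.compl_mul_add x 0 0
  mul_assoc := p.compl_mul_assoc
  left_distrib := p.compl_mul_add
  right_distrib := p.compl_add_mul
  norm_mul_le := p.compl_norm_mul_le
  star_involutive := p.compl_star_star
  star_mul := p.compl_star_mul
  star_add := p.compl_star_add
  norm_mul_self_le := p.compl_norm_mul_self_le
  smul_assoc := p.compl_smul_mul
  smul_comm c x y := (p.compl_mul_smul c x y).symm
  star_smul := p.compl_star_smul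

end Completion

end ContCStarSeminorm

/-! ### Hilbert modules over locally C⋆-algebras -/

/-- A Hilbert `A`-module: a complex vector space `E` with a compatible right `A`-action `rmul` and
an `A`-valued inner product, linear in the second variable, such that `E` is complete in the
topology given by the seminorms `ξ ↦ √(p ⟨ξ, ξ⟩)`, `p` a continuous C⋆-seminorm on `A`. Over a
C⋆-algebra this is a Hilbert C⋆-module. An element of `A` is positive if it is of the form
`star b * b`. -/
class HilbertModule (A E : Type*) [NonUnitalRing A] [StarRing A] [Module ℂ A] [UniformSpace A]
    [AddCommGroup E] [Module ℂ E] [UniformSpace E] extends Inner A E where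
  rmul : E → A → E
  rmul_add : ∀ (ξ : E) (a b : A), rmul ξ (a + b) = rmul ξ a + rmul ξ b
  add_rmul : ∀ (ξ η : E) (a : A), rmul (ξ + η) a = rmul ξ a + rmul η a
  rmul_mul : ∀ (ξ : E) (a b : A), rmul ξ (a * b) = rmul (rmul ξ a) b
  smul_rmul : ∀ (c : ℂ) (ξ : E) (a : A), rmul (c • ξ) a = c • rmul ξ a
  rmul_smul : ∀ (c : ℂ) (ξ : E) (a : A), rmul ξ (c • a) = c • rmul ξ a
  inner_add_right : ∀ ξ η ζ : E, inner ξ (η + ζ) = inner ξ η + inner ξ ζ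
  inner_smul_right : ∀ (c : ℂ) (ξ η : E), inner ξ (c • η) = c • inner ξ η
  inner_rmul_right : ∀ (ξ η : E) (a : A), inner ξ (rmul η a) = inner ξ η * a
  star_inner : ∀ ξ η : E, star (inner ξ η) = inner η ξ
  inner_self_nonneg : ∀ ξ : E, ∃ b : A, inner ξ ξ = star b * b
  inner_self_eq_zero : ∀ ξ : E, inner ξ ξ = 0 ↔ ξ = 0
  isUniformAddGroup : IsUniformAddGroup E
  nhds_zero : 𝓝 (0 : E) =
    ⨅ p : ContCStarSeminorm A, comap (fun ξ : E => √(p (inner ξ ξ))) (𝓝 (0 : ℝ))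
  complete : CompleteSpace E

namespace HilbertModule

variable (A : Type*) {E : Type*} [NonUnitalRing A] [StarRing A] [Module ℂ A] [UniformSpace A]
  [AddCommGroup E] [Module ℂ E] [UniformSpace E] [HilbertModule A E]

variable (E) in
/-- `E` is full: the linear span of the inner products is dense in `A`. -/
def IsFull : Prop :=
  Dense (Submodule.span ℂ (Set.range fun x : E × E => inner A x.1 x.2) : Set A)

variable {A}

/-- The seminorm `ξ ↦ √(p ⟨ξ, ξ⟩)` on `E`. -/
def bar (p : ContCStarSeminorm A) (ξ : E) : ℝ := √(p (inner A ξ ξ))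

theorem bar_nonneg (p : ContCStarSeminorm A) (ξ : E) : 0 ≤ bar p ξ := Real.sqrt_nonneg _

theorem bar_sq (p : ContCStarSeminorm A) (ξ : E) : bar p ξ ^ 2 = p (inner A ξ ξ) :=
  Real.sq_sqrt (apply_nonneg p _)

variable (A) in
theorem inner_add_left (ξ η ζ : E) : inner A (ξ + η) ζ = inner A ξ ζ + inner A η ζ := by
  rw [← star_inner, inner_add_right, star_add, star_inner, star_inner]

theorem inner_rmul_left (ξ η : E) (a : A) : inner A (rmul ξ a) η = star a * inner A ξ η := by
  rw [← star_inner, inner_rmul_right, star_mul, star_inner]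

variable (A) in
theorem inner_zero_right (ξ : E) : inner A ξ (0 : E) = 0 := by
  simpa using inner_smul_right (A := A) (0 : ℂ) ξ 0

variable (A) in
theorem inner_sub_right (ξ η ζ : E) : inner A ξ (η - ζ) = inner A ξ η - inner A ξ ζ := by
  rw [eq_sub_iff_add_eq, ← inner_add_right, sub_add_cancel]

variable (A) in
theorem inner_sub_left (ξ η ζ : E) : inner A (ξ - η) ζ = inner A ξ ζ - inner A η ζ := by
  rw [eq_sub_iff_add_eq, ← inner_add_left, sub_add_cancel]

variable (A) in
theorem ext_inner_left {ξ η : E} (h : ∀ ζ : E, inner A ζ ξ = inner A ζ η) : ξ = η := by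
  rw [← sub_eq_zero, ← inner_self_eq_zero (A := A), inner_sub_right, h, sub_self]

variable (A) in
theorem ext_inner_right {ξ η : E} (h : ∀ ζ : E, inner A ξ ζ = inner A η ζ) : ξ = η :=
  ext_inner_left A fun ζ => by rw [← star_inner, h, star_inner]

section StarModule

variable [StarModule ℂ A]

variable (A) in
theorem inner_smul_left (c : ℂ) (ξ η : E) : inner A (c • ξ) η = star c • inner A ξ η := by
  rw [← star_inner, inner_smul_right, star_smul, star_inner]

theorem bar_smul (p : ContCStarSeminorm A) (c : ℂ) (ξ : E) : bar p (c • ξ) = ‖c‖ * bar p ξ := by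
  rw [bar, inner_smul_right, inner_smul_left, map_smul_eq_mul, map_smul_eq_mul, norm_star,
    ← mul_assoc, Real.sqrt_mul (by positivity), Real.sqrt_mul_self (norm_nonneg _)]
  rfl

theorem bar_neg (p : ContCStarSeminorm A) (ξ : E) : bar p (-ξ) = bar p ξ := by
  simpa using bar_smul p (-1) ξ

variable [IsScalarTower ℂ A A] [SMulCommClass ℂ A A]

/-- The Cauchy–Schwarz inequality. -/
theorem apply_inner_le (p : ContCStarSeminorm A) (ξ η : E) :
    p (inner A ξ η) ≤ bar p ξ * bar p η := by
  let _ := CStarAlgebra.spectralOrder p.Compl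
  have := CStarAlgebra.spectralOrderedRing p.Compl
  have hpos : ∀ ζ : E, 0 ≤ p.toCompl (inner A ζ ζ) := fun ζ => by
    obtain ⟨b, hb⟩ := inner_self_nonneg (A := A) ζ
    rw [hb, p.toCompl_mul, p.toCompl_star]
    exact star_mul_self_nonneg (p.toCompl b)
  have key : ∀ M : ℝ, 0 < M → p (inner A ξ ξ) ≤ M →
      p (inner A ξ η) ^ 2 ≤ M * p (inner A η η) := by
    intro M hM hN
    set x := inner A ξ η with hx
    set X := p.toCompl x with hX
    set C := p.toCompl (inner A η η) with hC
    have h1 : inner A (rmul ξ x - (M : ℂ) • η) (rmul ξ x - (M : ℂ) • η) +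
        ((M : ℂ) • (star x * x) + (M : ℂ) • (star x * x)) =
        star x * inner A ξ ξ * x + (M : ℂ) • ((M : ℂ) • inner A η η) := by
      have hs : star x = inner A η ξ := star_inner _ _
      simp only [inner_sub_right, inner_sub_left, inner_rmul_right, inner_rmul_left,
        inner_smul_right, inner_smul_left, ← hx, hs, sub_mul, smul_mul_assoc, smul_sub,
        RCLike.star_def, Complex.conj_ofReal]
      abel
    have h2 := congrArg p.toCompl h1
    simp only [p.toCompl_add, p.toCompl_smul, p.toCompl_mul, p.toCompl_star, ← hX, ← hC] at h2
    have h3 : star X * p.toCompl (inner A ξ ξ) * X ≤ (M : ℝ) • (star X * X) := by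
      refine (CStarAlgebra.star_left_conjugate_le_norm_smul
        (hb := IsSelfAdjoint.of_nonneg (hpos ξ))).trans ?_
      rw [p.norm_toCompl]
      exact smul_le_smul_of_nonneg_right hN (star_mul_self_nonneg _)
    have h4 : (M : ℝ) • (star X * X) + (M : ℝ) • (star X * X) ≤
        (M : ℝ) • (star X * X) + (M : ℝ) • ((M : ℝ) • C) := by
      have h5 : (M : ℝ) • (star X * X) + (M : ℝ) • (star X * X) ≤
          star X * p.toCompl (inner A ξ ξ) * X + (M : ℝ) • ((M : ℝ) • C) := by
        have h6 := hpos (rmul ξ x - (M : ℂ) • η)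
        simp only [Complex.coe_smul] at h2
        rw [← h2]
        exact le_add_of_nonneg_left h6
      exact h5.trans (add_le_add_left h3 _)
    have h7 : star X * X ≤ (M : ℝ) • C :=
      (smul_le_smul_iff_of_pos_left hM).1 (le_of_add_le_add_left h4)
    have h8 := CStarAlgebra.norm_le_norm_of_nonneg_of_le (star_mul_self_nonneg X) h7
    rw [CStarRing.norm_star_mul_self, norm_smul, Real.norm_of_nonneg hM.le, hX, hC,
      p.norm_toCompl, p.norm_toCompl] at h8
    rw [sq]
    exact h8
  have h9 : p (inner A ξ η) ^ 2 ≤ p (inner A ξ ξ) * p (inner A η η) := by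
    have hc : Tendsto (fun M : ℝ => M * p (inner A η η)) (𝓝[>] p (inner A ξ ξ))
        (𝓝 (p (inner A ξ ξ) * p (inner A η η))) :=
      tendsto_nhdsWithin_of_tendsto_nhds ((continuous_id.mul continuous_const).tendsto _)
    refine ge_of_tendsto hc ?_
    filter_upwards [self_mem_nhdsWithin] with M hM
    exact key M ((apply_nonneg p _).trans_lt hM) (le_of_lt hM)
  refine le_of_sq_le_sq ?_ (mul_nonneg (bar_nonneg p ξ) (bar_nonneg p η))
  rwa [mul_pow, bar_sq, bar_sq]

theorem bar_add_le (p : ContCStarSeminorm A) (ξ η : E) : bar p (ξ + η) ≤ bar p ξ + bar p η := by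
  refine le_of_sq_le_sq ?_ (add_nonneg (bar_nonneg p ξ) (bar_nonneg p η))
  rw [bar_sq, inner_add_right, inner_add_left, inner_add_left]
  have h1 := map_add_le_add p (inner A ξ ξ + inner A η ξ) (inner A ξ η + inner A η η)
  have h2 := map_add_le_add p (inner A ξ ξ) (inner A η ξ)
  have h3 := map_add_le_add p (inner A ξ η) (inner A η η)
  have h4 := apply_inner_le p ξ η
  have h5 := apply_inner_le p η ξ
  have h6 := bar_sq p ξ
  have h7 := bar_sq p η
  nlinarith

end StarModule

theorem bar_rmul_le (p : ContCStarSeminorm A) (ξ : E) (a : A) :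
    bar p (rmul ξ a) ≤ bar p ξ * p a := by
  refine le_of_sq_le_sq ?_ (mul_nonneg (bar_nonneg p ξ) (apply_nonneg p a))
  rw [bar_sq, inner_rmul_right, inner_rmul_left, mul_pow, bar_sq]
  have h1 := p.mul_le (star a * inner A ξ ξ) a
  have h2 := p.mul_le (star a) (inner A ξ ξ)
  rw [p.map_star] at h2
  nlinarith [apply_nonneg p a]

theorem bar_zero (p : ContCStarSeminorm A) : bar p (0 : E) = 0 := by
  rw [bar, inner_zero_right, map_zero, Real.sqrt_zero]

end HilbertModule

/-! ### Adjointable and compact operators -/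

namespace HilbertModule

section Operators

variable (A E : Type*) [NonUnitalRing A] [StarRing A] [Module ℂ A] [UniformSpace A]
  [AddCommGroup E] [Module ℂ E] [UniformSpace E] [HilbertModule A E]

variable {E} in
/-- `S` is an adjoint of `T`. -/
def AdjointPair (T S : Module.End ℂ E) : Prop :=
  ∀ ξ η : E, inner A (T ξ) η = inner A ξ (S η)

variable {E} in
/-- `T` commutes with the right action of `A`. -/
def RightLinear (T : Module.End ℂ E) : Prop :=
  ∀ (ξ : E) (a : A), T (rmul ξ a) = rmul (T ξ) a

variable {A} {E} in
theorem AdjointPair.symm {T S : Module.End ℂ E} (h : AdjointPair A T S) : AdjointPair A S T :=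
  fun ξ η => by rw [← star_inner, ← h, star_inner]

variable [IsLocallyCStarAlgebra A]

/-- `L(E)`, the algebra of adjointable module morphisms from `E` to `E`. -/
def Adjointable : Subalgebra ℂ (Module.End ℂ E) where
  carrier := {T | RightLinear A T ∧ ∃ S, RightLinear A S ∧ AdjointPair A T S}
  mul_mem' := by
    rintro T T' ⟨hT, S, hS, hTS⟩ ⟨hT', S', hS', hTS'⟩
    refine ⟨fun ξ a => ?_, S' * S, fun ξ a => ?_, fun ξ η => ?_⟩
    · simp only [Module.End.mul_apply, hT' ξ a, hT _ a]
    · simp only [Module.End.mul_apply, hS ξ a, hS' _ a]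
    · simp only [Module.End.mul_apply, hTS _ η, hTS' ξ _]
  add_mem' := by
    rintro T T' ⟨hT, S, hS, hTS⟩ ⟨hT', S', hS', hTS'⟩
    refine ⟨fun ξ a => ?_, S + S', fun ξ a => ?_, fun ξ η => ?_⟩
    · simp only [LinearMap.add_apply, hT ξ a, hT' ξ a, add_rmul]
    · simp only [LinearMap.add_apply, hS ξ a, hS' ξ a, add_rmul]
    · simp only [LinearMap.add_apply, inner_add_left, inner_add_right, hTS ξ η, hTS' ξ η]
  algebraMap_mem' c := by
    refine ⟨fun ξ a => ?_, algebraMap ℂ _ (star c), fun ξ a => ?_, fun ξ η => ?_⟩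
    · simp only [Module.algebraMap_end_apply, smul_rmul]
    · simp only [Module.algebraMap_end_apply, smul_rmul]
    · simp only [Module.algebraMap_end_apply, inner_smul_left, inner_smul_right]

variable {A E}

instance : FunLike (Adjointable A E) E E where
  coe T := T.1
  coe_injective _ _ h := Subtype.ext (DFunLike.coe_injective h)

namespace Adjointable

@[ext]
theorem ext {T S : Adjointable A E} (h : ∀ ξ, T ξ = S ξ) : T = S := DFunLike.ext _ _ h

theorem add_apply (T S : Adjointable A E) (ξ : E) : (T + S) ξ = T ξ + S ξ := rfl
theorem sub_apply (T S : Adjointable A E) (ξ : E) : (T - S) ξ = T ξ - S ξ := rfl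
theorem neg_apply (T : Adjointable A E) (ξ : E) : (-T) ξ = -T ξ := rfl
theorem zero_apply (ξ : E) : (0 : Adjointable A E) ξ = 0 := rfl
theorem smul_apply (c : ℂ) (T : Adjointable A E) (ξ : E) : (c • T) ξ = c • T ξ := rfl
theorem mul_apply (T S : Adjointable A E) (ξ : E) : (T * S) ξ = T (S ξ) := rfl
theorem map_sub (T : Adjointable A E) (ξ η : E) : T (ξ - η) = T ξ - T η :=
  LinearMap.map_sub T.1 ξ η
theorem map_rmul (T : Adjointable A E) (ξ : E) (a : A) : T (rmul ξ a) = rmul (T ξ) a :=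
  T.2.1 ξ a

/-- The adjoint of an adjointable operator. -/
instance : Star (Adjointable A E) where
  star T := ⟨T.2.2.choose, T.2.2.choose_spec.1, T.1, T.2.1, T.2.2.choose_spec.2.symm⟩

theorem inner_apply_left (T : Adjointable A E) (ξ η : E) :
    inner A (T ξ) η = inner A ξ (star T η) := T.2.2.choose_spec.2 ξ η

theorem inner_apply_right (T : Adjointable A E) (ξ η : E) :
    inner A ξ (T η) = inner A (star T ξ) η := by
  rw [← star_inner, inner_apply_left, star_inner]

instance : StarRing (Adjointable A E) where
  star_involutive T := by
    ext η
    refine ext_inner_left A fun ζ => ?_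
    rw [← inner_apply_left, ← inner_apply_right]
  star_mul T S := by
    ext η
    refine ext_inner_left A fun ζ => ?_
    simp only [← inner_apply_left, mul_apply]
  star_add T S := by
    ext η
    refine ext_inner_left A fun ζ => ?_
    simp only [← inner_apply_left, add_apply, inner_add_left, inner_add_right]

instance : StarModule ℂ (Adjointable A E) where
  star_smul c T := by
    ext η
    refine ext_inner_left A fun ζ => ?_
    simp only [← inner_apply_left, smul_apply, inner_smul_left, inner_smul_right]

/-- The set of operators whose operator norm with respect to each of the finitely many seminorms
`bar p`, `p ∈ F`, is at most `ε`. -/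
def ball (F : Finset (ContCStarSeminorm A)) (ε : ℝ) : Set (Adjointable A E) :=
  {T | ∀ p ∈ F, ∀ ξ, bar p (T ξ) ≤ ε * bar p ξ}

open Classical in
/-- The neighbourhoods of `0` for the topology of `L(E)`, which is the one given by the operator
seminorms `T ↦ sup {bar p (T ξ) | bar p ξ ≤ 1}`, `p` a continuous C⋆-seminorm on `A`. -/
@[reducible]
def filterBasis : AddGroupFilterBasis (Adjointable A E) :=
  addGroupFilterBasisOfComm {U | ∃ F ε, 0 < ε ∧ U = ball F ε}
    ⟨_, ∅, 1, one_pos, rfl⟩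
    (by
      rintro _ _ ⟨F, ε, hε, rfl⟩ ⟨F', ε', hε', rfl⟩
      refine ⟨ball (F ∪ F') (min ε ε'), ⟨_, _, lt_min hε hε', rfl⟩, fun T hT => ⟨?_, ?_⟩⟩
      · exact fun p hp ξ => (hT p (Finset.mem_union_left _ hp) ξ).trans
          (mul_le_mul_of_nonneg_right (min_le_left _ _) (bar_nonneg p ξ))
      · exact fun p hp ξ => (hT p (Finset.mem_union_right _ hp) ξ).trans
          (mul_le_mul_of_nonneg_right (min_le_right _ _) (bar_nonneg p ξ)))
    (by
      rintro _ ⟨F, ε, hε, rfl⟩ p hp ξ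
      rw [zero_apply, bar_zero]
      exact mul_nonneg hε.le (bar_nonneg p ξ))
    (by
      rintro _ ⟨F, ε, hε, rfl⟩
      refine ⟨ball F (ε / 2), ⟨_, _, half_pos hε, rfl⟩, ?_⟩
      rintro _ ⟨T, hT, S, hS, rfl⟩ p hp ξ
      have h1 := bar_add_le p (T ξ) (S ξ)
      have h2 := hT p hp ξ
      have h3 := hS p hp ξ
      change bar p (T ξ + S ξ) ≤ _
      linarith)
    (by
      rintro _ ⟨F, ε, hε, rfl⟩
      refine ⟨ball F ε, ⟨_, _, hε, rfl⟩, fun T hT p hp ξ => ?_⟩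
      rw [neg_apply, bar_neg]
      exact hT p hp ξ)

instance : TopologicalSpace (Adjointable A E) := filterBasis.topology

instance : IsTopologicalAddGroup (Adjointable A E) := filterBasis.isTopologicalAddGroup

theorem mem_closure_iff {s : Set (Adjointable A E)} {T : Adjointable A E} :
    T ∈ closure s ↔ ∀ F ε, 0 < ε → ∃ S ∈ s, S - T ∈ ball F ε := by
  rw [mem_closure_iff_nhds_basis (filterBasis.nhds_hasBasis T)]
  constructor
  · rintro h F ε hε
    obtain ⟨S, hS, V, hV, rfl⟩ := h (ball F ε) ⟨F, ε, hε, rfl⟩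
    exact ⟨_, hS, by simpa using hV⟩
  · rintro h _ ⟨F, ε, hε, rfl⟩
    obtain ⟨S, hS, hV⟩ := h F ε hε
    exact ⟨S, hS, S - T, hV, by simp⟩

/-- The rank one operator `θ_{ξ,η} : ζ ↦ ξ⟨η, ζ⟩`. -/
def rankOne (ξ η : E) : Adjointable A E :=
  ⟨{ toFun := fun ζ => rmul ξ (inner A η ζ)
     map_add' := fun ζ ω => by rw [inner_add_right, rmul_add]
     map_smul' := fun c ζ => by rw [inner_smul_right, rmul_smul]; rfl },
    fun ζ a => by
      simp only [LinearMap.coe_mk, AddHom.coe_mk, inner_rmul_right, rmul_mul],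
    { toFun := fun ζ => rmul η (inner A ξ ζ)
      map_add' := fun ζ ω => by rw [inner_add_right, rmul_add]
      map_smul' := fun c ζ => by rw [inner_smul_right, rmul_smul]; rfl },
    fun ζ a => by
      simp only [LinearMap.coe_mk, AddHom.coe_mk, inner_rmul_right, rmul_mul],
    fun ζ ω => by
      simp only [LinearMap.coe_mk, AddHom.coe_mk, inner_rmul_right, inner_rmul_left, star_inner]⟩

theorem rankOne_apply (ξ η ζ : E) : (rankOne ξ η : Adjointable A E) ζ = rmul ξ (inner A η ζ) := rfl

theorem star_rankOne (ξ η : E) : star (rankOne ξ η : Adjointable A E) = rankOne η ξ := by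
  ext ζ
  refine ext_inner_left A fun ω => ?_
  rw [← inner_apply_left, rankOne_apply, rankOne_apply, inner_rmul_left, inner_rmul_right,
    star_inner]

theorem mul_rankOne (T : Adjointable A E) (ξ η : E) : T * rankOne ξ η = rankOne (T ξ) η := by
  ext ζ
  rw [mul_apply, rankOne_apply, rankOne_apply, map_rmul]

variable (A E) in
/-- `Θ(E)`, the linear span of the rank one operators. -/
def finiteRank : Submodule ℂ (Adjointable A E) :=
  Submodule.span ℂ (Set.range fun x : E × E => rankOne x.1 x.2)

theorem mul_mem_finiteRank (T : Adjointable A E) {S : Adjointable A E}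
    (hS : S ∈ finiteRank A E) : T * S ∈ finiteRank A E := by
  induction hS using Submodule.span_induction with
  | mem S hS =>
    obtain ⟨x, rfl⟩ := hS
    exact Submodule.subset_span ⟨(T x.1, x.2), (mul_rankOne T x.1 x.2).symm⟩
  | zero => rw [mul_zero]; exact zero_mem _
  | add S S' _ _ h h' => rw [mul_add]; exact add_mem h h'
  | smul c S _ h => rw [mul_smul_comm]; exact Submodule.smul_mem _ c h

theorem star_mem_finiteRank {S : Adjointable A E}
    (hS : S ∈ finiteRank A E) : star S ∈ finiteRank A E := by
  induction hS using Submodule.span_induction with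
  | mem S hS =>
    obtain ⟨x, rfl⟩ := hS
    exact Submodule.subset_span ⟨(x.2, x.1), (star_rankOne x.1 x.2).symm⟩
  | zero => rw [star_zero]; exact zero_mem _
  | add S S' _ _ h h' => rw [star_add]; exact add_mem h h'
  | smul c S _ h => rw [star_smul]; exact Submodule.smul_mem _ _ h

theorem exists_bound_of_mem_finiteRank (p : ContCStarSeminorm A) {S : Adjointable A E}
    (hS : S ∈ finiteRank A E) : ∃ M, 0 ≤ M ∧ ∀ ξ, bar p (S ξ) ≤ M * bar p ξ := by
  induction hS using Submodule.span_induction with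
  | mem S hS =>
    obtain ⟨⟨ξ, η⟩, rfl⟩ := hS
    refine ⟨bar p ξ * bar p η, mul_nonneg (bar_nonneg p ξ) (bar_nonneg p η), fun ζ => ?_⟩
    rw [rankOne_apply, mul_assoc]
    exact (bar_rmul_le p ξ _).trans
      (mul_le_mul_of_nonneg_left (apply_inner_le p η ζ) (bar_nonneg p ξ))
  | zero => exact ⟨0, le_rfl, fun ξ => by rw [zero_apply, bar_zero, zero_mul]⟩
  | add S S' _ _ h h' =>
    obtain ⟨M, hM, h⟩ := h
    obtain ⟨M', hM', h'⟩ := h'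
    refine ⟨M + M', add_nonneg hM hM', fun ξ => (bar_add_le p (S ξ) (S' ξ)).trans ?_⟩
    rw [add_mul]
    exact add_le_add (h ξ) (h' ξ)
  | smul c S _ h =>
    obtain ⟨M, hM, h⟩ := h
    refine ⟨‖c‖ * M, mul_nonneg (norm_nonneg c) hM, fun ξ => ?_⟩
    rw [smul_apply, bar_smul, mul_assoc]
    exact mul_le_mul_of_nonneg_left (h ξ) (norm_nonneg c)

theorem exists_bound_of_mem_closure (p : ContCStarSeminorm A) {T : Adjointable A E}
    (hT : T ∈ closure (finiteRank A E : Set (Adjointable A E))) :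
    ∃ M, 0 ≤ M ∧ ∀ ξ, bar p (T ξ) ≤ M * bar p ξ := by
  obtain ⟨S, hS, hST⟩ := mem_closure_iff.1 hT {p} 1 one_pos
  obtain ⟨M, hM, h⟩ := exists_bound_of_mem_finiteRank p hS
  refine ⟨M + 1, by linarith, fun ξ => ?_⟩
  have h1 := hST p (Finset.mem_singleton_self p) ξ
  have h2 := bar_add_le p (S ξ) (-((S - T) ξ))
  rw [bar_neg] at h2
  have h3 : S ξ + -((S - T) ξ) = T ξ := by rw [sub_apply]; abel
  rw [h3] at h2
  have h4 := h ξ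
  linarith

theorem star_mem_ball {F : Finset (ContCStarSeminorm A)} {ε : ℝ} (hε : 0 ≤ ε)
    {T : Adjointable A E} (hT : T ∈ ball F ε) : star T ∈ ball F ε := by
  intro p hp ξ
  have h1 : bar p (star T ξ) ^ 2 ≤ bar p (T (star T ξ)) * bar p ξ := by
    rw [bar_sq, ← inner_apply_left]
    exact apply_inner_le p _ _
  have h2 := hT p hp (star T ξ)
  rcases (bar_nonneg p (star T ξ)).eq_or_lt with h0 | h0
  · rw [← h0]
    exact mul_nonneg hε (bar_nonneg p ξ)
  · have h3 := mul_le_mul_of_nonneg_right h2 (bar_nonneg p ξ)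
    nlinarith

end Adjointable

open Adjointable

variable (A E) in
/-- `K(E)`, the closure in `L(E)` of the linear span of the rank one operators, as a ⋆-algebra
with the topology of `L(E)`. -/
def Compact : NonUnitalStarSubalgebra ℂ (Adjointable A E) where
  carrier := closure (finiteRank A E : Set (Adjointable A E))
  zero_mem' := subset_closure (zero_mem (finiteRank A E))
  add_mem' hT hS := (finiteRank A E).toAddSubgroup.topologicalClosure.add_mem hT hS
  smul_mem' c T hT := by
    rw [Adjointable.mem_closure_iff] at hT ⊢
    intro F ε hε
    obtain ⟨S, hS, h⟩ := hT F (ε / (‖c‖ + 1)) (by positivity)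
    refine ⟨c • S, Submodule.smul_mem _ c hS, fun p hp ξ => ?_⟩
    rw [← smul_sub, Adjointable.smul_apply, bar_smul]
    refine (mul_le_mul_of_nonneg_left (h p hp ξ) (norm_nonneg c)).trans ?_
    rw [← mul_assoc]
    refine mul_le_mul_of_nonneg_right ?_ (bar_nonneg p ξ)
    rw [mul_div_assoc', div_le_iff₀ (by positivity)]
    nlinarith [norm_nonneg c]
  mul_mem' {T S} hT hS := by
    choose M hM0 hM using fun p => exists_bound_of_mem_closure p hT
    rw [Adjointable.mem_closure_iff] at hS ⊢
    intro F ε hε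
    have hN : 0 ≤ ∑ p ∈ F, M p := Finset.sum_nonneg fun p _ => hM0 p
    obtain ⟨S', hS', h⟩ := hS F (ε / (∑ p ∈ F, M p + 1)) (by positivity)
    refine ⟨T * S', mul_mem_finiteRank T hS', fun p hp ξ => ?_⟩
    rw [← mul_sub, mul_apply]
    refine (hM p _).trans ((mul_le_mul_of_nonneg_left (h p hp ξ) (hM0 p)).trans ?_)
    rw [← mul_assoc]
    refine mul_le_mul_of_nonneg_right ?_ (bar_nonneg p ξ)
    rw [mul_div_assoc', div_le_iff₀ (by positivity)]
    nlinarith [Finset.single_le_sum (fun p _ => hM0 p) hp]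
  star_mem' {T} hT := by
    rw [Adjointable.mem_closure_iff] at hT ⊢
    intro F ε hε
    obtain ⟨S, hS, h⟩ := hT F ε hε
    have h' := star_mem_ball hε.le h
    rw [star_sub] at h'
    exact ⟨star S, star_mem_finiteRank hS, h'⟩

/-- The rank one operator `θ_{ξ,η}` as an element of `K(E)`. -/
def theta (A : Type*) {E : Type*} [NonUnitalRing A] [StarRing A] [Module ℂ A] [UniformSpace A]
    [AddCommGroup E] [Module ℂ E] [UniformSpace E] [HilbertModule A E] [IsLocallyCStarAlgebra A]
    (ξ η : E) : Compact A E :=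
  ⟨rankOne ξ η, subset_closure (Submodule.subset_span ⟨(ξ, η), rfl⟩)⟩

end Operators

end HilbertModule

/-! ### Group actions on locally C⋆-algebras -/

/-- `Aut(A)`: the ⋆-automorphisms of `A` that are continuous together with their inverses. -/
def ContStarAut (A : Type*) [NonUnitalRing A] [StarRing A] [Module ℂ A] [TopologicalSpace A] :
    Subgroup (A ≃⋆ₐ[ℂ] A) where
  carrier := {φ | Continuous φ ∧ Continuous φ.symm}
  one_mem' := ⟨continuous_id, continuous_id⟩
  mul_mem' h h' := ⟨h.1.comp h'.1, h'.2.comp h.2⟩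
  inv_mem' h := ⟨h.2, h.1⟩

/-- An inverse system of C⋆-algebras over a preordered set. -/
structure CStarSystem (Λ : Type w) [Preorder Λ] where
  alg : Λ → Type v
  [cstar : ∀ i, NonUnitalCStarAlgebra (alg i)]
  map : ∀ {i j : Λ}, j ≤ i → (alg i →⋆ₙₐ[ℂ] alg j)
  map_self : ∀ (i : Λ) (x : alg i), map (le_refl i) x = x
  map_map : ∀ {i j k : Λ} (hij : j ≤ i) (hjk : k ≤ j) (x : alg i),
    map hjk (map hij x) = map (hjk.trans hij) x

attribute [instance] CStarSystem.cstar

/-- An identification of the topological ⋆-algebra `A` with the inverse limit of an inverse system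
of C⋆-algebras, i.e. with the ⋆-algebra of coherent families with the product topology; it is
given by its components `proj i`. -/
structure CStarSystem.Limit {Λ : Type*} [Preorder Λ] (S : CStarSystem Λ) (A : Type*)
    [NonUnitalRing A] [StarRing A] [Module ℂ A] [TopologicalSpace A] where
  proj : ∀ i, A →⋆ₙₐ[ℂ] S.alg i
  map_proj : ∀ {i j : Λ} (h : j ≤ i) (a : A), S.map h (proj i a) = proj j a
  existsUnique : ∀ x : ∀ i, S.alg i, (∀ {i j : Λ} (h : j ≤ i), S.map h (x i) = x j) →
    ∃! a : A, ∀ i, proj i a = x i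
  isInducing : IsInducing fun (a : A) (i : Λ) => proj i a

namespace ContStarAut

variable {G : Type*} [Group G]

section

universe u

variable {A : Type u} [NonUnitalRing A] [StarRing A] [Module ℂ A] [TopologicalSpace A]

/-- The action `α` of `G` on `A` is continuous. -/
def IsContinuousAction [TopologicalSpace G] (α : G →* ContStarAut A) : Prop :=
  ∀ a : A, Continuous fun g => (α g).1 a

/-- The action `α` is an inverse limit action: `A` is the limit of an inverse system (over a
directed set) of C⋆-algebras `A_i`, and `α` is the limit of an inverse system of actions of `G` on
the `A_i`. -/
def IsInverseLimitAction (α : G →* ContStarAut A) : Prop :=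
  ∃ (Λ : Type u) (_ : Preorder Λ) (_ : IsDirectedOrder Λ) (_ : Nonempty Λ)
    (S : CStarSystem.{u, u} Λ) (P : S.Limit A) (α' : ∀ i, G →* ContStarAut (S.alg i)),
    (∀ (g : G) (i j : Λ) (h : j ≤ i) (x : S.alg i),
      S.map h ((α' i g).1 x) = (α' j g).1 (S.map h x)) ∧
    ∀ (g : G) (i : Λ) (a : A), P.proj i ((α g).1 a) = (α' i g).1 (P.proj i a)

/-- The `G`-invariant continuous C⋆-seminorms are cofinal among all continuous C⋆-seminorms. -/
def HasCofinalInvariantSeminorms (α : G →* ContStarAut A) : Prop :=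
  ∀ q : ContCStarSeminorm A, ∃ p : ContCStarSeminorm A,
    (∀ (g : G) (a : A), p ((α g).1 a) = p a) ∧ ∀ a : A, q a ≤ p a

/-- A continuous inverse limit action: a continuous action that is an inverse limit action and has
a cofinal set of invariant continuous C⋆-seminorms. -/
def IsContinuousInverseLimitAction [TopologicalSpace G] (α : G →* ContStarAut A) : Prop :=
  IsContinuousAction α ∧ IsInverseLimitAction α ∧ HasCofinalInvariantSeminorms α

end

end ContStarAut

/-! ### Group actions on Hilbert modules -/

/-- A map `u : E → F` is a morphism of Hilbert modules if there is a morphism `α : A → B` of locally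
C⋆-algebras with `⟨u ξ, u η⟩ = α ⟨ξ, η⟩`. -/
def IsHilbertModuleMorphism (A B : Type*) {E F : Type*}
    [NonUnitalRing A] [StarRing A] [Module ℂ A] [UniformSpace A]
    [AddCommGroup E] [Module ℂ E] [UniformSpace E] [HilbertModule A E]
    [NonUnitalRing B] [StarRing B] [Module ℂ B] [UniformSpace B]
    [AddCommGroup F] [Module ℂ F] [UniformSpace F] [HilbertModule B F] (u : E → F) : Prop :=
  ∃ α : A →⋆ₙₐ[ℂ] B, Continuous α ∧ ∀ ξ η : E, inner B (u ξ) (u η) = α (inner A ξ η)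

/-- `Aut(E)`: the bijections `u` of `E` such that `u` and its inverse are morphisms of Hilbert
modules. -/
def HilbertAut (A E : Type*) [NonUnitalRing A] [StarRing A] [Module ℂ A] [UniformSpace A]
    [AddCommGroup E] [Module ℂ E] [UniformSpace E] [HilbertModule A E] :
    Subgroup (Equiv.Perm E) where
  carrier := {u | IsHilbertModuleMorphism A A u ∧ IsHilbertModuleMorphism A A u.symm}
  one_mem' := ⟨⟨NonUnitalStarAlgHom.id ℂ A, continuous_id, fun _ _ => rfl⟩,
    ⟨NonUnitalStarAlgHom.id ℂ A, continuous_id, fun _ _ => rfl⟩⟩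
  mul_mem' := by
    rintro u v ⟨⟨α, hα, hu⟩, α', hα', hu'⟩ ⟨⟨β, hβ, hv⟩, β', hβ', hv'⟩
    refine ⟨⟨α.comp β, hα.comp hβ, fun ξ η => ?_⟩, β'.comp α', hβ'.comp hα', fun ξ η => ?_⟩
    · exact (hu _ _).trans (congrArg α (hv _ _))
    · exact (hv' _ _).trans (congrArg β' (hu' _ _))
  inv_mem' h := ⟨h.2, h.1⟩

set_option linter.checkUnivs false in
/-- An inverse system of Hilbert C⋆-modules over an inverse system of C⋆-algebras. -/
structure HilbertSystem (Λ : Type w) [Preorder Λ] extends CStarSystem.{w, v} Λ where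
  mod : Λ → Type x
  [addCommGroup : ∀ i, AddCommGroup (mod i)]
  [module : ∀ i, Module ℂ (mod i)]
  [uniformSpace : ∀ i, UniformSpace (mod i)]
  [hilbertModule : ∀ i, HilbertModule (alg i) (mod i)]
  mmap : ∀ {i j : Λ}, j ≤ i → (mod i →ₗ[ℂ] mod j)
  mmap_rmul : ∀ {i j : Λ} (h : j ≤ i) (ξ : mod i) (a : alg i),
    mmap h (HilbertModule.rmul ξ a) = HilbertModule.rmul (mmap h ξ) (map h a)
  inner_mmap : ∀ {i j : Λ} (h : j ≤ i) (ξ η : mod i),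
    inner (alg j) (mmap h ξ) (mmap h η) = map h (inner (alg i) ξ η)
  mmap_self : ∀ (i : Λ) (ξ : mod i), mmap (le_refl i) ξ = ξ
  mmap_mmap : ∀ {i j k : Λ} (hij : j ≤ i) (hjk : k ≤ j) (ξ : mod i),
    mmap hjk (mmap hij ξ) = mmap (hjk.trans hij) ξ

attribute [instance] HilbertSystem.addCommGroup HilbertSystem.module HilbertSystem.uniformSpace
  HilbertSystem.hilbertModule

/-- An identification of the Hilbert `A`-module `E` with the inverse limit of an inverse system of
Hilbert C⋆-modules: `A` is identified with the limit of the C⋆-algebras, and `E` with the module of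
coherent families, compatibly with the linear structure, the module action and the inner products.
(The topologies then correspond to each other automatically.) -/
structure HilbertSystem.Limit {Λ : Type*} [Preorder Λ] (S : HilbertSystem Λ) (A E : Type*)
    [NonUnitalRing A] [StarRing A] [Module ℂ A] [UniformSpace A]
    [AddCommGroup E] [Module ℂ E] [UniformSpace E] [HilbertModule A E] where
  algLimit : S.toCStarSystem.Limit A
  mproj : ∀ i, E →ₗ[ℂ] S.mod i
  mproj_rmul : ∀ (i : Λ) (ξ : E) (a : A),
    mproj i (HilbertModule.rmul ξ a) = HilbertModule.rmul (mproj i ξ) (algLimit.proj i a)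
  inner_mproj : ∀ (i : Λ) (ξ η : E),
    inner (S.alg i) (mproj i ξ) (mproj i η) = algLimit.proj i (inner A ξ η)
  mmap_mproj : ∀ {i j : Λ} (h : j ≤ i) (ξ : E), S.mmap h (mproj i ξ) = mproj j ξ
  existsUnique : ∀ x : ∀ i, S.mod i, (∀ {i j : Λ} (h : j ≤ i), S.mmap h (x i) = x j) →
    ∃! ξ : E, ∀ i, mproj i ξ = x i

namespace HilbertAut

variable {G : Type*} [Group G] {A E : Type*}
  [NonUnitalRing A] [StarRing A] [Module ℂ A] [UniformSpace A]
  [AddCommGroup E] [Module ℂ E] [UniformSpace E] [HilbertModule A E]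

/-- The action `u` of `G` on `E` is continuous. -/
def IsContinuousAction [TopologicalSpace G] (u : G →* HilbertAut A E) : Prop :=
  ∀ ξ : E, Continuous fun g => (u g).1 ξ

/-- The action `u` is an inverse limit action: `E` is the limit of an inverse system (over a
directed set) of Hilbert C⋆-modules `E_i`, and `u` is the limit of an inverse system of actions of
`G` on the `E_i`. -/
def IsInverseLimitAction (u : G →* HilbertAut A E) : Prop :=
  ∃ (Λ : Type w) (_ : Preorder Λ) (_ : IsDirectedOrder Λ) (_ : Nonempty Λ)
    (S : HilbertSystem.{w, v, x} Λ) (P : S.Limit A E)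
    (u' : ∀ i, G →* HilbertAut (S.alg i) (S.mod i)),
    (∀ (g : G) (i j : Λ) (h : j ≤ i) (ξ : S.mod i),
      S.mmap h ((u' i g).1 ξ) = (u' j g).1 (S.mmap h ξ)) ∧
    ∀ (g : G) (i : Λ) (ξ : E), P.mproj i ((u g).1 ξ) = (u' i g).1 (P.mproj i ξ)

/-- A continuous inverse limit action of `G` on `E`. -/
def IsContinuousInverseLimitAction [TopologicalSpace G] (u : G →* HilbertAut A E) :
    Prop :=
  IsContinuousAction u ∧ IsInverseLimitAction.{w, v, x} u

end HilbertAut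

end

/-! ### Continuous C⋆-seminorms -/

/-! The first two claims rest on density. An automorphism `u` of `E` comes with some continuous
⋆-endomorphism of `A`, fixed on inner products. Since `E` is full, it is fixed everywhere
(`hom_eq_of_forall_inner`), so it depends multiplicatively on `u` and is invertible. On `K(E)` the
automorphism is conjugation `T ↦ u T u⁻¹`, which sends `θ_{ξ,η}` to `θ_{uξ,uη}`. It is continuous
because `u` turns the seminorm of `p` into that of `p ∘ φ` (`continuous_conj`). Uniqueness holds
because the rank one operators span a dense subspace.

The third claim goes through invariant seminorms. An inverse limit presentation provides the
seminorms `a ↦ ‖proj i a‖`. They are invariant, because the action on `E_i` is accompanied by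
⋆-homomorphisms of `A_i`, and these are contractive (`norm_proj_toContStarAut_le`). They are
cofinal, because a C⋆-seminorm that is bounded by a multiple of another is bounded by the other
itself: apply the C⋆-identity to the powers `b ^ 2 ^ n` and take roots (`le_of_le_const_mul`).

Conversely, cofinality of the invariant seminorms is all that is needed for a continuous inverse
limit action. The action is isometric for each of them, so continuity of orbit maps passes from a
set with dense span to the whole algebra (`HasCofinalInvariantSeminorms.isContinuousAction`).
Moreover the algebra is the limit of its completions for these seminorms, and the action extends to
each completion (`HasCofinalInvariantSeminorms.isInverseLimitAction`).

To apply this to `K(E)`, it is shown to be a locally C⋆-algebra whose topology is given by the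
operator seminorms `opNorm p`. An invariant `p` on `A` yields an invariant `opNorm p`, and these are
again cofinal. The point there is that `opNorm p` increases with `p`, although the unit balls change
as well; this is `bound_of_le`, another argument with iterated squares. -/

theorem le_of_forall_pow_two_pow_le {x y C : ℝ} (hy : 0 ≤ y)
    (h : ∀ n : ℕ, x ^ 2 ^ n ≤ C * y ^ 2 ^ n) : x ≤ y := by
  by_contra! hxy
  rcases hy.eq_or_lt with rfl | hy
  · have := h 0
    simp only [pow_zero, pow_one, mul_zero] at this
    exact this.not_gt hxy
  -- If `x > y > 0`, then `(x / y) ^ 2 ^ n` outgrows any constant; only exponents `2 ^ n` are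
  -- available because the C⋆-identity squares.
  · have h1 : Tendsto (fun n : ℕ => (x / y) ^ 2 ^ n) atTop atTop :=
      (tendsto_pow_atTop_atTop_of_one_lt ((one_lt_div hy).2 hxy)).comp
        (tendsto_pow_atTop_atTop_of_one_lt one_lt_two)
    obtain ⟨n, hn⟩ := (h1.eventually_gt_atTop C).exists
    rw [div_pow, lt_div_iff₀ (by positivity)] at hn
    exact (h n).not_gt hn

namespace ContCStarSeminorm

variable {A B : Type*} [NonUnitalRing A] [StarRing A] [Module ℂ A] [TopologicalSpace A]
  [NonUnitalRing B] [StarRing B] [Module ℂ B] [TopologicalSpace B]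

theorem continuous (p : ContCStarSeminorm A) : Continuous p := p.continuous'

theorem tendsto_zero (p : ContCStarSeminorm A) : Tendsto p (𝓝 0) (𝓝 0) := by
  simpa using p.continuous.tendsto 0

noncomputable instance : Zero (ContCStarSeminorm A) where
  zero :=
    { toSeminorm := 0
      mul_le' := fun _ _ => (mul_zero (0 : ℝ)).ge
      star_mul_self' := fun _ => (zero_pow two_ne_zero).symm
      continuous' := continuous_const }

noncomputable instance : Max (ContCStarSeminorm A) where
  max p q :=
    { toSeminorm := p.toSeminorm ⊔ q.toSeminorm
      mul_le' := fun a b => by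
        change max (p (a * b)) (q (a * b)) ≤ max (p a) (q a) * max (p b) (q b)
        refine max_le ((p.mul_le a b).trans ?_) ((q.mul_le a b).trans ?_)
        · exact mul_le_mul (le_max_left _ _) (le_max_left _ _) (apply_nonneg p b)
            ((apply_nonneg p a).trans (le_max_left _ _))
        · exact mul_le_mul (le_max_right _ _) (le_max_right _ _) (apply_nonneg q b)
            ((apply_nonneg q a).trans (le_max_right _ _))
      star_mul_self' := fun a => by
        change max (p (star a * a)) (q (star a * a)) = max (p a) (q a) ^ 2
        rw [p.star_mul_self, q.star_mul_self]
        rcases le_total (p a) (q a) with h | h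
        · rw [max_eq_right h, max_eq_right (pow_le_pow_left₀ (apply_nonneg p a) h 2)]
        · rw [max_eq_left h, max_eq_left (pow_le_pow_left₀ (apply_nonneg q a) h 2)]
      continuous' := p.continuous.max q.continuous }

theorem max_apply (p q : ContCStarSeminorm A) (a : A) : max p q a = max (p a) (q a) := rfl

instance : Preorder (ContCStarSeminorm A) := Preorder.lift fun p => (p : A → ℝ)

/-- The pullback of a continuous C⋆-seminorm along a continuous ⋆-homomorphism. -/
def comp (p : ContCStarSeminorm B) (φ : A →⋆ₙₐ[ℂ] B) (hφ : Continuous φ) :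
    ContCStarSeminorm A where
  toFun a := p (φ a)
  map_zero' := by rw [_root_.map_zero φ, _root_.map_zero p]
  add_le' a b := by rw [map_add φ]; exact map_add_le_add p _ _
  neg' a := by rw [map_neg φ, map_neg_eq_map]
  smul' c a := by rw [_root_.map_smul φ, map_smul_eq_mul]
  mul_le' a b := by rw [map_mul φ]; exact p.mul_le _ _
  star_mul_self' a := by rw [map_mul φ, StarHomClass.map_star φ]; exact p.star_mul_self _
  continuous' := p.continuous.comp hφ

/-- The norm of a C⋆-algebra. -/
noncomputable def ofNorm (B : Type*) [NonUnitalCStarAlgebra B] : ContCStarSeminorm B where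
  toSeminorm := normSeminorm ℂ B
  mul_le' := norm_mul_le
  star_mul_self' a := by
    change ‖star a * a‖ = ‖a‖ ^ 2
    rw [CStarRing.norm_star_mul_self, sq]
  continuous' := continuous_norm

/-- A C⋆-seminorm which is bounded by a multiple of another one is bounded by the latter. -/
theorem le_of_le_const_mul {p q : ContCStarSeminorm A} {C : ℝ} (h : ∀ a, q a ≤ C * p a) :
    q ≤ p := by
  -- For self-adjoint `b` the C⋆-identity reads `p (b * b) = p b ^ 2`, so the bound for `b * b` at
  -- level `n` is the one for `b` at level `n + 1`, with the same `C`.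
  have key : ∀ (n : ℕ) (b : A), star b = b → q b ^ 2 ^ n ≤ C * p b ^ 2 ^ n := by
    intro n
    induction n with
    | zero => simpa using fun b _ => h b
    | succ n ih =>
      intro b hb
      have h1 := ih (b * b) (by rw [star_mul, hb])
      have h2 := q.star_mul_self b
      have h3 := p.star_mul_self b
      rw [hb] at h2 h3
      rwa [h2, h3, ← pow_mul, ← pow_mul, ← pow_succ'] at h1
  intro a
  refine le_of_sq_le_sq ?_ (apply_nonneg p a)
  rw [← p.star_mul_self, ← q.star_mul_self]
  exact le_of_forall_pow_two_pow_le (apply_nonneg p _)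
    fun n => key n _ (by rw [star_mul, star_star])

/-- Homogeneity gives `q ≤ (2 / ε) p`, and `le_of_le_const_mul` discards the constant. Continuity of
`q` thus turns into domination by a single seminorm. -/
theorem le_of_forall_lt {p q : ContCStarSeminorm A} {ε : ℝ} (hε : 0 < ε)
    (h : ∀ a, p a < ε → q a < 1) : q ≤ p := by
  refine le_of_le_const_mul (C := 2 / ε) fun a => ?_
  refine le_of_forall_pos_le_add fun δ hδ => ?_
  -- The extra summand keeps `s` positive when `p a = 0`, so that `a` can be rescaled by `ε / (2 *
  -- s)`; it contributes exactly `δ` to `2 * s / ε`.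
  have hs : 0 < p a + δ * ε / 2 := add_pos_of_nonneg_of_pos (apply_nonneg p a) (by positivity)
  set s := p a + δ * ε / 2
  have hps : p a ≤ s := le_add_of_nonneg_right (by positivity)
  have hc : ‖((ε / (2 * s) : ℝ) : ℂ)‖ = ε / (2 * s) := by
    rw [Complex.norm_real, Real.norm_of_nonneg (by positivity)]
  have h1 := h (((ε / (2 * s) : ℝ) : ℂ) • a) (by
    rw [map_smul_eq_mul, hc, div_mul_eq_mul_div, div_lt_iff₀ (by positivity)]
    nlinarith)
  rw [map_smul_eq_mul, hc, div_mul_eq_mul_div, div_lt_one (by positivity)] at h1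
  have h2 : 2 / ε * p a + δ = 2 * s / ε := by
    simp only [s]; field_simp
  rw [h2, le_div_iff₀ hε]
  linarith

/-! ### Extension of contractive ⋆-homomorphisms to completions -/

section Completion

theorem toCompl_sub (p : ContCStarSeminorm A) (a b : A) :
    p.toCompl (a - b) = p.toCompl a - p.toCompl b :=
  UniformSpace.Completion.coe_sub (α := p.Pre) a b

theorem norm_toCompl_sub (p : ContCStarSeminorm A) (a b : A) :
    ‖p.toCompl a - p.toCompl b‖ = p (a - b) := by
  rw [← toCompl_sub, norm_toCompl]

variable (p : ContCStarSeminorm A) (q : ContCStarSeminorm B) (φ : A →⋆ₙₐ[ℂ] B)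

/-- The map of completions which extends a contractive ⋆-homomorphism. -/
noncomputable def complFun : p.Compl → q.Compl :=
  UniformSpace.Completion.map (fun a : p.Pre => (show q.Pre from φ a))

theorem continuous_complFun : Continuous (complFun p q φ) :=
  UniformSpace.Completion.continuous_map

variable {p q φ}

theorem complFun_toCompl (h : ∀ a, q (φ a) ≤ p a) (a : A) :
    complFun p q φ (p.toCompl a) = q.toCompl (φ a) :=
  UniformSpace.Completion.map_coe (α := p.Pre) (β := q.Pre)
    (AddMonoidHomClass.uniformContinuous_of_bound (E := p.Pre) (F := q.Pre)
      (⟨⟨fun a => φ a, _root_.map_zero φ⟩, map_add φ⟩ : p.Pre →+ q.Pre) 1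
      fun a => by rw [one_mul]; exact h a) a

variable [IsScalarTower ℂ A A] [SMulCommClass ℂ A A] [StarModule ℂ A]
    [IsScalarTower ℂ B B] [SMulCommClass ℂ B B] [StarModule ℂ B]

variable (p q φ) in
/-- A ⋆-homomorphism which is contractive for given C⋆-seminorms extends to the completions. -/
noncomputable def complMap (h : ∀ a, q (φ a) ≤ p a) : p.Compl →⋆ₙₐ[ℂ] q.Compl where
  toFun := complFun p q φ
  map_smul' c x := by
    have hc := continuous_complFun p q φ
    exact p.compl_induction x
      (isClosed_eq (hc.comp (p.compl_continuous_smul c)) ((q.compl_continuous_smul c).comp hc))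
      fun a => by
        rw [← toCompl_smul, complFun_toCompl h, complFun_toCompl h, _root_.map_smul φ,
          toCompl_smul]
        rfl
  map_zero' := by rw [← toCompl_zero, complFun_toCompl h, _root_.map_zero φ, toCompl_zero]
  map_add' x y := by
    have hc := continuous_complFun p q φ
    exact p.compl_induction₂ x y (isClosed_eq (by fun_prop) (by fun_prop))
      fun a b => by simp only [← toCompl_add, complFun_toCompl h, map_add φ]
  map_mul' x y := by
    have hc := continuous_complFun p q φ
    exact p.compl_induction₂ x y (isClosed_eq (by fun_prop) (by fun_prop))
      fun a b => by simp only [← toCompl_mul, complFun_toCompl h, map_mul φ]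
  map_star' x := by
    have hc := continuous_complFun p q φ
    exact p.compl_induction x (isClosed_eq (by fun_prop) (by fun_prop))
      fun a => by simp only [← toCompl_star, complFun_toCompl h, StarHomClass.map_star φ]

theorem complMap_toCompl (h : ∀ a, q (φ a) ≤ p a) (a : A) :
    complMap p q φ h (p.toCompl a) = q.toCompl (φ a) := complFun_toCompl h a

theorem continuous_complMap (h : ∀ a, q (φ a) ≤ p a) : Continuous (complMap p q φ h) :=
  continuous_complFun p q φ

/-- The canonical map of `A` into its completion with respect to `p`, as a ⋆-homomorphism. -/
noncomputable def toComplHom (p : ContCStarSeminorm A) : A →⋆ₙₐ[ℂ] p.Compl where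
  toFun := p.toCompl
  map_smul' := p.toCompl_smul
  map_zero' := p.toCompl_zero
  map_add' := p.toCompl_add
  map_mul' := p.toCompl_mul
  map_star' := p.toCompl_star

end Completion

end ContCStarSeminorm

/-! ### Convergence in a locally C⋆-algebra -/

namespace IsLocallyCStarAlgebra

variable {A : Type*} [NonUnitalRing A] [StarRing A] [Module ℂ A] [UniformSpace A]
  [IsLocallyCStarAlgebra A]

theorem tendsto_iff {X : Type*} {l : Filter X} {f : X → A} {a : A} :
    Tendsto f l (𝓝 a) ↔ ∀ p : ContCStarSeminorm A, Tendsto (fun x => p (f x - a)) l (𝓝 0) := by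
  rw [← nhds_translation_sub, tendsto_comap_iff, nhds_zero]
  simp only [tendsto_iInf, tendsto_comap_iff]
  rfl

theorem eq_zero_of_forall {a : A} (h : ∀ p : ContCStarSeminorm A, p a = 0) : a = 0 := by
  have : Tendsto (fun _ : Unit => a) ⊤ (𝓝 0) := tendsto_iff.2 fun p => by
    simpa only [sub_zero, h] using tendsto_const_nhds
  exact tendsto_nhds_unique tendsto_const_nhds this

theorem continuous_const_smul' (c : ℂ) : Continuous fun a : A => c • a := by
  refine continuous_iff_continuousAt.2 fun a => tendsto_iff.2 fun p => ?_
  have h : Tendsto (fun b : A => ‖c‖ * p (b - a)) (𝓝 a) (𝓝 (‖c‖ * 0)) :=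
    (tendsto_iff.1 tendsto_id p).const_mul _
  rw [mul_zero] at h
  refine h.congr fun b => ?_
  rw [← smul_sub, map_smul_eq_mul]

end IsLocallyCStarAlgebra

/-! ### Actions with cofinally many invariant seminorms -/

namespace ContStarAut

universe u

variable {G : Type*} [Group G] {A : Type u} [NonUnitalRing A] [StarRing A] [Module ℂ A]
  [UniformSpace A] {α : G →* ContStarAut A}

open ContCStarSeminorm hiding max_apply

/-- Needed for `K(E)`, whose neighbourhoods of `0` are indexed by finite sets of seminorms on `A`. A
maximum of two continuous C⋆-seminorms is one again, and cofinality is applied to it. -/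
theorem HasCofinalInvariantSeminorms.exists_forall_mem_le
    (hα : HasCofinalInvariantSeminorms α) (F : Finset (ContCStarSeminorm A)) :
    ∃ p : ContCStarSeminorm A, (∀ (g : G) (a : A), p ((α g).1 a) = p a) ∧ ∀ q ∈ F, q ≤ p := by
  classical
  induction F using Finset.induction_on with
  | empty => exact ⟨0, fun _ _ => rfl, by simp⟩
  | insert q F _ ih =>
    obtain ⟨p, -, hp⟩ := ih
    obtain ⟨r, hr, hr'⟩ := hα (max q p)
    refine ⟨r, hr, fun s hs a => ?_⟩
    rcases Finset.mem_insert.1 hs with rfl | hs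
    · exact (le_max_left _ _).trans (hr' a)
    · exact (hp s hs a).trans ((le_max_right _ _).trans (hr' a))

/-- The invariant continuous C⋆-seminorms of an action. -/
abbrev InvariantSeminorm (α : G →* ContStarAut A) : Type u :=
  {p : ContCStarSeminorm A // ∀ (g : G) (a : A), p ((α g).1 a) = p a}

theorem isDirectedOrder_invariantSeminorm (α : G →* ContStarAut A) :
    IsDirectedOrder (InvariantSeminorm α) :=
  ⟨fun p q => ⟨⟨max p.1 q.1, fun g a => by
      rw [ContCStarSeminorm.max_apply, ContCStarSeminorm.max_apply, p.2, q.2]⟩,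
    fun _ => le_max_left _ _, fun _ => le_max_right _ _⟩⟩

variable [IsLocallyCStarAlgebra A]

/-- Invariant seminorms make the family of all `α g` equicontinuous, so an `ε / 3` argument carries
continuity of orbit maps from the span of `s` to its closure. -/
theorem HasCofinalInvariantSeminorms.isContinuousAction [TopologicalSpace G]
    (hα : HasCofinalInvariantSeminorms α) {s : Set A}
    (hs : Dense (Submodule.span ℂ s : Set A))
    (h : ∀ a ∈ s, Continuous fun g => (α g).1 a) : IsContinuousAction α := by
  have hspan : ∀ a ∈ Submodule.span ℂ s, Continuous fun g => (α g).1 a := by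
    intro a ha
    induction ha using Submodule.span_induction with
    | mem a ha => exact h a ha
    | zero => simpa only [_root_.map_zero] using continuous_const
    | add a b _ _ ha hb => simp only [map_add]; exact ha.add hb
    | smul c a _ ha =>
      simp only [_root_.map_smul]
      exact (IsLocallyCStarAlgebra.continuous_const_smul' c).comp ha
  intro a
  refine continuous_iff_continuousAt.2 fun g₀ => IsLocallyCStarAlgebra.tendsto_iff.2 fun q => ?_
  obtain ⟨p, hp, hqp⟩ := hα q
  rw [Metric.tendsto_nhds]
  intro ε hε
  obtain ⟨b, hb, hbs⟩ : ∃ b, p (b - a) < ε / 3 ∧ b ∈ Submodule.span ℂ s := by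
    have hU : IsOpen {b | p (b - a) < ε / 3} :=
      isOpen_lt (p.continuous.comp (continuous_id.sub continuous_const)) continuous_const
    have := hs.inter_open_nonempty _ hU ⟨a, by
      change p (a - a) < ε / 3
      rw [sub_self, _root_.map_zero]; positivity⟩
    obtain ⟨b, hb, hb'⟩ := this
    exact ⟨b, hb, hb'⟩
  have h1 := IsLocallyCStarAlgebra.tendsto_iff.1 ((hspan b hbs).tendsto g₀) p
  filter_upwards [(Metric.tendsto_nhds.1 h1) (ε / 3) (by positivity)] with g hg
  rw [dist_zero_right, Real.norm_of_nonneg (apply_nonneg _ _)] at hg ⊢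
  -- By invariance the outer two terms have `p`-value `p (b - a) < ε / 3`, independently of `g`.
  have h2 : (α g).1 a - (α g₀).1 a =
      (-(α g).1 (b - a) + ((α g).1 b - (α g₀).1 b)) + (α g₀).1 (b - a) := by
    simp only [_root_.map_sub]; abel
  refine (hqp _).trans_lt ?_
  rw [h2]
  have h3 := map_add_le_add p (-(α g).1 (b - a) + ((α g).1 b - (α g₀).1 b)) ((α g₀).1 (b - a))
  have h4 := map_add_le_add p (-(α g).1 (b - a)) ((α g).1 b - (α g₀).1 b)
  rw [map_neg_eq_map, hp] at h4
  rw [hp] at h3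
  linarith

/-- The inverse system of the completions of `A` with respect to the invariant seminorms. -/
noncomputable def invariantSystem (α : G →* ContStarAut A) :
    CStarSystem.{u, u} (InvariantSeminorm α) where
  alg p := p.1.Compl
  map {p q} h := complMap p.1 q.1 (NonUnitalStarAlgHom.id ℂ A) fun a => h a
  map_self p x := p.1.compl_induction x
    (isClosed_eq (continuous_complMap _) continuous_id) fun a => complMap_toCompl _ a
  map_map {p q r} _ _ x := p.1.compl_induction x
    (isClosed_eq ((continuous_complMap _).comp (continuous_complMap _)) (continuous_complMap _))
    fun a => (congrArg (complMap q.1 r.1 (NonUnitalStarAlgHom.id ℂ A) _)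
      (complMap_toCompl _ a)).trans ((complMap_toCompl _ a).trans (complMap_toCompl _ a).symm)

theorem invariantSystem_map_toCompl {p q : InvariantSeminorm α} (h : q ≤ p) (a : A) :
    (invariantSystem α).map h (p.1.toCompl a) = q.1.toCompl a :=
  complMap_toCompl (fun a => h a) a

theorem continuous_invariantSystem_map {p q : InvariantSeminorm α} (h : q ≤ p) :
    Continuous ((invariantSystem α).map h) :=
  continuous_complMap (p := p.1) (q := q.1) fun a => h a

/-- By cofinality the invariant seminorms alone already generate the topology. -/
theorem HasCofinalInvariantSeminorms.nhds_zero (hα : HasCofinalInvariantSeminorms α) :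
    𝓝 (0 : A) = ⨅ p : InvariantSeminorm α, comap p.1 (𝓝 (0 : ℝ)) := by
  refine le_antisymm (le_iInf fun p => ?_) ?_
  · exact tendsto_iff_comap.1 p.1.tendsto_zero
  · rw [IsLocallyCStarAlgebra.nhds_zero (A := A)]
    refine le_iInf fun q => ?_
    obtain ⟨p, hp, hqp⟩ := hα q
    refine (iInf_le _ ⟨p, hp⟩).trans ?_
    rw [← tendsto_iff_comap]
    exact squeeze_zero (fun a => apply_nonneg q a) hqp tendsto_comap

theorem HasCofinalInvariantSeminorms.eq_of_forall (hα : HasCofinalInvariantSeminorms α) {a b : A}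
    (h : ∀ p : InvariantSeminorm α, p.1.toCompl a = p.1.toCompl b) : a = b := by
  rw [← sub_eq_zero]
  refine IsLocallyCStarAlgebra.eq_zero_of_forall fun q => ?_
  obtain ⟨p, hp, hqp⟩ := hα q
  refine le_antisymm ((hqp _).trans ?_) (apply_nonneg q _)
  rw [← norm_toCompl_sub, h ⟨p, hp⟩, sub_self, norm_zero]

theorem continuous_toCompl (p : ContCStarSeminorm A) : Continuous p.toCompl := by
  refine continuous_iff_continuousAt.2 fun a => ?_
  rw [ContinuousAt, tendsto_iff_norm_sub_tendsto_zero]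
  refine (IsLocallyCStarAlgebra.tendsto_iff.1 tendsto_id p).congr fun b =>
    (p.norm_toCompl_sub b a).symm

/-- The preimages in `A` of the neighbourhoods of all `x p` generate a filter `F`. It is proper,
because the family is directed and `A` has dense image in each completion. It is Cauchy, because its
image in each completion converges. Completeness of `A` supplies the element. -/
theorem HasCofinalInvariantSeminorms.exists_toCompl_eq (hα : HasCofinalInvariantSeminorms α)
    (x : ∀ p : InvariantSeminorm α, p.1.Compl)
    (hx : ∀ {p q : InvariantSeminorm α} (h : q ≤ p), (invariantSystem α).map h (x p) = x q) :
    ∃ a : A, ∀ p : InvariantSeminorm α, p.1.toCompl a = x p := by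
  have := isDirectedOrder_invariantSeminorm α
  have hne : Nonempty (InvariantSeminorm α) := ⟨⟨0, fun _ _ => rfl⟩⟩
  let F : Filter A := ⨅ p : InvariantSeminorm α, comap p.1.toCompl (𝓝 (x p))
  have hF : ∀ p : InvariantSeminorm α, Tendsto p.1.toCompl F (𝓝 (x p)) := fun p =>
    tendsto_iff_comap.2 (iInf_le _ p)
  -- This is where coherence of `x` enters: the connecting map is continuous and sends `x p` to `x
  -- q`.
  have hanti : Antitone fun p : InvariantSeminorm α => comap p.1.toCompl (𝓝 (x p)) := by
    intro q p h
    rw [← tendsto_iff_comap]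
    have h1 : Tendsto ((invariantSystem α).map h) (𝓝 (x p)) (𝓝 (x q)) := by
      rw [← hx h]
      exact (continuous_invariantSystem_map h).tendsto _
    exact (h1.comp tendsto_comap).congr fun a => invariantSystem_map_toCompl h a
  have : F.NeBot := iInf_neBot_of_directed hanti.directed_ge fun p =>
    comap_neBot_iff_frequently.2 (mem_closure_iff_frequently.1 (p.1.denseRange_toCompl _))
  have hC : Cauchy F := by
    refine ⟨this, ?_⟩
    rw [uniformity_eq_comap_nhds_zero, ← tendsto_iff_comap, hα.nhds_zero]
    refine tendsto_iInf.2 fun p => tendsto_comap_iff.2 ?_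
    have h1 := (((hF p).comp tendsto_snd).sub ((hF p).comp tendsto_fst) :
      Tendsto _ (F ×ˢ F) _)
    rw [sub_self] at h1
    have h2 := h1.norm
    rw [norm_zero] at h2
    refine h2.congr fun y => p.1.norm_toCompl_sub y.2 y.1
  obtain ⟨a, ha⟩ := CompleteSpace.complete hC
  exact ⟨a, fun p => tendsto_nhds_unique (((continuous_toCompl p.1).tendsto a).mono_left ha) (hF p)⟩

theorem HasCofinalInvariantSeminorms.isInducing_toCompl (hα : HasCofinalInvariantSeminorms α) :
    IsInducing fun (a : A) (p : InvariantSeminorm α) => p.1.toCompl a := by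
  have hc : Continuous fun (a : A) (p : InvariantSeminorm α) => p.1.toCompl a :=
    continuous_pi fun p => continuous_toCompl p.1
  refine isInducing_iff_nhds.2 fun a => le_antisymm ?_ ?_
  · exact tendsto_iff_comap.1 (hc.tendsto a)
  · rw [← nhds_translation_sub a, hα.nhds_zero, comap_iInf]
    refine le_iInf fun p => ?_
    rw [comap_comap, ← tendsto_iff_comap]
    have h0 : Tendsto (fun x : ∀ p : InvariantSeminorm α, p.1.Compl => x p)
        (𝓝 fun p => p.1.toCompl a) (𝓝 (p.1.toCompl a)) := (continuous_apply p).tendsto _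
    have h1 : Tendsto (fun b => p.1.toCompl b)
        (comap (fun (a : A) (p : InvariantSeminorm α) => p.1.toCompl a)
          (𝓝 fun p => p.1.toCompl a)) (𝓝 (p.1.toCompl a)) :=
      h0.comp tendsto_comap
    rw [tendsto_iff_norm_sub_tendsto_zero] at h1
    exact h1.congr fun b => p.1.norm_toCompl_sub b a

/-- `A` is the inverse limit of its completions with respect to a cofinal set of seminorms. -/
noncomputable def invariantLimit (hα : HasCofinalInvariantSeminorms α) :
    (invariantSystem α).Limit A where
  proj p := p.1.toComplHom
  map_proj h a := invariantSystem_map_toCompl h a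
  existsUnique x hx := by
    obtain ⟨a, ha⟩ := hα.exists_toCompl_eq x hx
    exact ⟨a, ha, fun b hb => hα.eq_of_forall fun p => (hb p).trans (ha p).symm⟩
  isInducing := hα.isInducing_toCompl

/-- The ⋆-homomorphism induced by `α g` on the completion with respect to an invariant seminorm. -/
noncomputable def complHom (p : InvariantSeminorm α) (g : G) : p.1.Compl →⋆ₙₐ[ℂ] p.1.Compl :=
  complMap p.1 p.1 ((α g).1 : A →⋆ₙₐ[ℂ] A) fun a => (p.2 g a).le

theorem complHom_toCompl (p : InvariantSeminorm α) (g : G) (a : A) :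
    complHom p g (p.1.toCompl a) = p.1.toCompl ((α g).1 a) :=
  complMap_toCompl (p := p.1) (q := p.1) (φ := ((α g).1 : A →⋆ₙₐ[ℂ] A)) (fun a => (p.2 g a).le) a

theorem continuous_complHom (p : InvariantSeminorm α) (g : G) : Continuous (complHom p g) :=
  continuous_complMap _

theorem complHom_one (p : InvariantSeminorm α) (x : p.1.Compl) : complHom p 1 x = x :=
  p.1.compl_induction x (isClosed_eq (continuous_complHom p 1) continuous_id)
    fun a => by rw [complHom_toCompl, map_one]; rfl

theorem complHom_mul (p : InvariantSeminorm α) (g h : G) (x : p.1.Compl) :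
    complHom p (g * h) x = complHom p g (complHom p h x) :=
  p.1.compl_induction x (isClosed_eq (continuous_complHom p _)
    ((continuous_complHom p g).comp (continuous_complHom p h)))
    fun a => by rw [complHom_toCompl, complHom_toCompl, complHom_toCompl, map_mul]; rfl

/-- The automorphism induced by `α g` on the completion with respect to an invariant seminorm. -/
noncomputable def complAut (p : InvariantSeminorm α) (g : G) : ContStarAut p.1.Compl where
  val :=
    { toFun := complHom p g
      invFun := complHom p g⁻¹
      left_inv := fun x => by rw [← complHom_mul, inv_mul_cancel, complHom_one]
      right_inv := fun x => by rw [← complHom_mul, mul_inv_cancel, complHom_one]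
      map_mul' := map_mul (complHom p g)
      map_add' := map_add (complHom p g)
      map_star' := StarHomClass.map_star (complHom p g)
      map_smul' := _root_.map_smul (complHom p g) }
  property := ⟨continuous_complHom p g, continuous_complHom p g⁻¹⟩

/-- The action induced on the completion with respect to an invariant seminorm. -/
noncomputable def complAction (p : InvariantSeminorm α) : G →* ContStarAut p.1.Compl where
  toFun := complAut p
  map_one' := Subtype.ext (StarAlgEquiv.ext (complHom_one p))
  map_mul' g h := Subtype.ext (StarAlgEquiv.ext (complHom_mul p g h))

/-- Each `α g` is isometric for an invariant `p` and hence acts on the completion. Compatibility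
with the connecting maps is a closed condition and is clear on the image of `A`. -/
theorem HasCofinalInvariantSeminorms.isInverseLimitAction
    (hα : HasCofinalInvariantSeminorms α) : IsInverseLimitAction α := by
  refine ⟨InvariantSeminorm α, inferInstance, isDirectedOrder_invariantSeminorm α,
    ⟨⟨0, fun _ _ => rfl⟩⟩, invariantSystem α, invariantLimit hα, complAction,
    fun g p q h x => ?_, fun g p a => (complHom_toCompl p g a).symm⟩
  refine p.1.compl_induction (P := fun x => (invariantSystem α).map h (complHom p g x) =
    complHom q g ((invariantSystem α).map h x)) x ?_ fun a => ?_
  · exact isClosed_eq ((continuous_invariantSystem_map h).comp (continuous_complHom p g))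
      ((continuous_complHom q g).comp (continuous_invariantSystem_map h))
  · rw [complHom_toCompl, invariantSystem_map_toCompl, invariantSystem_map_toCompl]
    exact (complHom_toCompl q g a).symm

end ContStarAut

/-! ### The topology of a Hilbert module -/

namespace HilbertModule

variable (A : Type*) {E : Type*} [NonUnitalRing A] [StarRing A] [Module ℂ A] [UniformSpace A]
  [AddCommGroup E] [Module ℂ E] [UniformSpace E] [HilbertModule A E]

theorem tendsto_iff {X : Type*} {l : Filter X} {f : X → E} {ξ : E} :
    Tendsto f l (𝓝 ξ) ↔
      ∀ p : ContCStarSeminorm A, Tendsto (fun x => bar p (f x - ξ)) l (𝓝 0) := by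
  have := isUniformAddGroup (A := A) (E := E)
  rw [← nhds_translation_sub, tendsto_comap_iff, nhds_zero (A := A) (E := E)]
  simp only [tendsto_iInf, tendsto_comap_iff]
  rfl

theorem sub_rmul (ξ η : E) (a : A) : rmul (ξ - η) a = rmul ξ a - rmul η a := by
  rw [eq_sub_iff_add_eq, ← add_rmul, sub_add_cancel]

variable {A} in
-- Inner products separate points, so moving `T` to the other side makes linearity over `A`
-- automatic. Limits and conjugates of operators therefore only need an adjoint.
theorem AdjointPair.rightLinear {T S : Module.End ℂ E} (h : AdjointPair A T S) :
    RightLinear A T := fun ξ a => ext_inner_left A fun ζ => by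
  rw [inner_rmul_right, ← h.symm, ← h.symm, inner_rmul_right]

variable [IsLocallyCStarAlgebra A]

variable {A} in
theorem eq_zero_of_forall_bar {ξ : E} (h : ∀ p : ContCStarSeminorm A, bar p ξ = 0) : ξ = 0 := by
  rw [← inner_self_eq_zero (A := A)]
  refine IsLocallyCStarAlgebra.eq_zero_of_forall fun p => ?_
  rw [← bar_sq, h, zero_pow two_ne_zero]

theorem t2Space (A E : Type*) [NonUnitalRing A] [StarRing A] [Module ℂ A] [UniformSpace A]
    [IsLocallyCStarAlgebra A] [AddCommGroup E] [Module ℂ E] [UniformSpace E] [HilbertModule A E] :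
    T2Space E := by
  refine t2_iff_nhds.2 fun {ξ η} hne => ?_
  rw [← sub_eq_zero]
  refine eq_zero_of_forall_bar (A := A) fun p => ?_
  have h1 := (tendsto_iff A).1 (tendsto_id.mono_left inf_le_left : Tendsto id (𝓝 ξ ⊓ 𝓝 η) (𝓝 ξ)) p
  have h2 := (tendsto_iff A).1 (tendsto_id.mono_left inf_le_right : Tendsto id (𝓝 ξ ⊓ 𝓝 η) (𝓝 η)) p
  have h3 := h2.add h1
  rw [add_zero] at h3
  refine le_antisymm (ge_of_tendsto' h3 fun ζ => ?_) (bar_nonneg p _)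
  have h4 := bar_add_le p (ζ - η) (-(ζ - ξ))
  rw [bar_neg] at h4
  have h5 : ζ - η + -(ζ - ξ) = ξ - η := by abel
  rwa [h5] at h4

variable {A} in
theorem continuous_bar (p : ContCStarSeminorm A) : Continuous (bar p : E → ℝ) := by
  refine continuous_iff_continuousAt.2 fun ξ => ?_
  rw [ContinuousAt, tendsto_iff_dist_tendsto_zero]
  refine squeeze_zero (fun _ => dist_nonneg) (fun η => ?_) ((tendsto_iff A).1 tendsto_id p)
  have h1 := bar_add_le p (η - ξ) ξ
  have h2 := bar_add_le p (-(η - ξ)) η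
  rw [bar_neg] at h2
  rw [sub_add_cancel] at h1
  rw [neg_sub, sub_add_cancel] at h2
  rw [Real.dist_eq, abs_sub_le_iff, id]
  constructor <;> linarith

theorem tendsto_inner {X : Type*} {l : Filter X} {f h : X → E} {ξ η : E}
    (hf : Tendsto f l (𝓝 ξ)) (hh : Tendsto h l (𝓝 η)) :
    Tendsto (fun x => inner A (f x) (h x)) l (𝓝 (inner A ξ η)) := by
  refine IsLocallyCStarAlgebra.tendsto_iff.2 fun p => ?_
  have h1 := (((tendsto_iff A).1 hf p).mul (((continuous_bar p).tendsto η).comp hh)).add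
    (((tendsto_iff A).1 hh p).const_mul (bar p ξ))
  rw [zero_mul, mul_zero, add_zero] at h1
  refine squeeze_zero (fun _ => apply_nonneg p _) (fun x => ?_) h1
  have h2 : inner A (f x) (h x) - inner A ξ η = inner A (f x - ξ) (h x) + inner A ξ (h x - η) := by
    rw [inner_sub_left, inner_sub_right]; abel
  rw [h2]
  exact (map_add_le_add p _ _).trans (add_le_add (apply_inner_le p _ _) (apply_inner_le p _ _))

theorem continuous_const_smul' (A : Type*) {E : Type*} [NonUnitalRing A] [StarRing A]
    [Module ℂ A] [UniformSpace A]
    [IsLocallyCStarAlgebra A] [AddCommGroup E] [Module ℂ E] [UniformSpace E] [HilbertModule A E]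
    (c : ℂ) : Continuous fun ξ : E => c • ξ := by
  refine continuous_iff_continuousAt.2 fun ξ => (tendsto_iff A).2 fun p => ?_
  have h1 := ((tendsto_iff A).1 (tendsto_id (x := 𝓝 ξ)) p).const_mul ‖c‖
  rw [mul_zero] at h1
  refine h1.congr fun η => ?_
  rw [← smul_sub, bar_smul, id]

variable {A}

/-! ### The algebra of adjointable operators -/

namespace Adjointable

theorem nhds_zero_hasBasis : (𝓝 (0 : Adjointable A E)).HasBasis
    (fun i : Finset (ContCStarSeminorm A) × ℝ => 0 < i.2) fun i => ball i.1 i.2 := by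
  refine ⟨fun s => ?_⟩
  rw [filterBasis.nhds_zero_hasBasis.mem_iff]
  constructor
  · rintro ⟨_, ⟨F, ε, hε, rfl⟩, h⟩
    exact ⟨(F, ε), hε, h⟩
  · rintro ⟨⟨F, ε⟩, hε, h⟩
    exact ⟨ball F ε, ⟨F, ε, hε, rfl⟩, h⟩

theorem t2Space : T2Space (Adjointable A E) := by
  refine IsTopologicalAddGroup.t2Space_of_zero_sep fun T hT => ?_
  obtain ⟨ξ, hξ⟩ : ∃ ξ, T ξ ≠ 0 := by
    by_contra! h
    exact hT (ext h)
  obtain ⟨p, hp⟩ : ∃ p : ContCStarSeminorm A, bar p (T ξ) ≠ 0 := by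
    by_contra! h
    exact hξ (eq_zero_of_forall_bar h)
  have hp' := (bar_nonneg p (T ξ)).lt_of_ne' hp
  -- With this radius, membership of `T` in the ball would bound `bar p (T ξ)` by at most half of
  -- itself; the `+ 1` covers `bar p ξ = 0`.
  have h0 : 0 < bar p (T ξ) / (2 * (bar p ξ + 1)) := by
    have := bar_nonneg p ξ
    positivity
  refine ⟨_, nhds_zero_hasBasis.mem_of_mem (i := ({p}, _)) h0, fun h => ?_⟩
  have h1 := h p (Finset.mem_singleton_self p) ξ
  have h2 := bar_nonneg p ξ
  rw [div_mul_eq_mul_div, le_div_iff₀ (by positivity)] at h1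
  nlinarith

/-- Evaluation of operators at a vector. -/
def evalHom (ξ : E) : Adjointable A E →+ E where
  toFun T := T ξ
  map_zero' := rfl
  map_add' _ _ := rfl

theorem continuous_evalHom (ξ : E) : Continuous (evalHom ξ : Adjointable A E →+ E) := by
  have := isUniformAddGroup (A := A) (E := E)
  refine continuous_of_continuousAt_zero _ ((tendsto_iff A).2 fun p => ?_)
  rw [(nhds_zero_hasBasis (A := A) (E := E)).tendsto_iff Metric.nhds_basis_closedBall]
  intro ε hε
  have h0 : 0 < bar p ξ + 1 := add_pos_of_nonneg_of_pos (bar_nonneg p ξ) one_pos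
  refine ⟨({p}, ε / (bar p ξ + 1)), by positivity, fun T hT => ?_⟩
  have h1 := hT p (Finset.mem_singleton_self p) ξ
  rw [div_mul_eq_mul_div, le_div_iff₀ h0] at h1
  rw [_root_.map_zero, sub_zero, mem_closedBall_zero_iff, Real.norm_of_nonneg (bar_nonneg p _)]
  change bar p (T ξ) ≤ ε
  nlinarith [bar_nonneg p ξ]

/-- The adjoint as an additive map. -/
noncomputable def starHom : Adjointable A E →+ Adjointable A E where
  toFun T := star T
  map_zero' := star_zero _
  map_add' := star_add

theorem continuous_starHom : Continuous (starHom : Adjointable A E →+ Adjointable A E) := by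
  refine continuous_of_continuousAt_zero _ ?_
  rw [ContinuousAt, _root_.map_zero, nhds_zero_hasBasis.tendsto_iff nhds_zero_hasBasis]
  exact fun i hi => ⟨i, hi, fun T hT => star_mem_ball (le_of_lt hi) hT⟩

theorem map_add (T : Adjointable A E) (ξ η : E) : T (ξ + η) = T ξ + T η :=
  LinearMap.map_add T.1 ξ η

theorem map_smul (T : Adjointable A E) (c : ℂ) (ξ : E) : T (c • ξ) = c • T ξ :=
  LinearMap.map_smul T.1 c ξ

/-- An operator with an adjoint is adjointable. -/
def ofAdjointPair (T S : Module.End ℂ E) (h : AdjointPair A T S) : Adjointable A E :=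
  ⟨T, h.rightLinear, S, h.symm.rightLinear, h⟩

variable (A E) in
/-- The uniform structure of `L(E)`. -/
@[reducible] noncomputable def uniformSpace : UniformSpace (Adjointable A E) :=
  IsTopologicalAddGroup.rightUniformSpace _

/-! ### Completeness of `L(E)` -/

section Complete

attribute [local instance] uniformSpace

theorem isUniformAddGroup : IsUniformAddGroup (Adjointable A E) :=
  isUniformAddGroup_of_addCommGroup

attribute [local instance] isUniformAddGroup

theorem exists_tendsto_apply {l : Filter (Adjointable A E)} (hl : Cauchy l) :
    ∃ T : E → E, ∀ ξ, Tendsto (fun S : Adjointable A E => S ξ) l (𝓝 (T ξ)) := by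
  have := HilbertModule.isUniformAddGroup (A := A) (E := E)
  have := HilbertModule.complete (A := A) (E := E)
  have h : ∀ ξ : E, ∃ η, Tendsto (fun S : Adjointable A E => S ξ) l (𝓝 η) := fun ξ =>
    CompleteSpace.complete
      (hl.map (uniformContinuous_addMonoidHom_of_continuous (continuous_evalHom ξ)))
  choose T hT using h
  exact ⟨T, hT⟩

/-- Pointwise limits of operators are linear. -/
noncomputable def endOfTendsto {l : Filter (Adjointable A E)} [l.NeBot] (T : E → E)
    (hT : ∀ ξ, Tendsto (fun S : Adjointable A E => S ξ) l (𝓝 (T ξ))) : Module.End ℂ E where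
  toFun := T
  map_add' ξ η := by
    have := HilbertModule.isUniformAddGroup (A := A) (E := E)
    have := HilbertModule.t2Space A E
    refine tendsto_nhds_unique (hT _) (((hT ξ).add (hT η)).congr fun S => ?_)
    exact (map_add S ξ η).symm
  map_smul' c ξ := by
    have := HilbertModule.t2Space A E
    refine tendsto_nhds_unique (hT _)
      ((((continuous_const_smul' A c).tendsto _).comp (hT ξ)).congr fun S => ?_)
    exact (map_smul S c ξ).symm

/-- Evaluation and the adjoint are continuous, so along a Cauchy filter both the operators and their
adjoints converge pointwise. The adjoint relation survives in the limit, and the Cauchy condition,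
being uniform in the vector, upgrades pointwise convergence to convergence in `L(E)`. -/
theorem completeSpace : CompleteSpace (Adjointable A E) := by
  have := HilbertModule.isUniformAddGroup (A := A) (E := E)
  have := HilbertModule.t2Space A E
  refine ⟨fun {l} hl => ?_⟩
  have := hl.1
  obtain ⟨T, hT⟩ := exists_tendsto_apply hl
  obtain ⟨S, hS⟩ := exists_tendsto_apply
    (hl.map (uniformContinuous_addMonoidHom_of_continuous continuous_starHom))
  have hadj : AdjointPair A (endOfTendsto T hT) (endOfTendsto S hS) := fun ξ η => by
    have h1 := tendsto_inner A (hT ξ) (tendsto_const_nhds (x := η))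
    have h2 := tendsto_inner A (tendsto_const_nhds (x := ξ)) (tendsto_map'_iff.1 (hS η))
    refine tendsto_nhds_unique h1 (h2.congr fun R => ?_)
    exact (inner_apply_left R ξ η).symm
  refine ⟨ofAdjointPair _ _ hadj, ?_⟩
  rw [← nhds_translation_sub, ← tendsto_iff_comap, nhds_zero_hasBasis.tendsto_right_iff]
  rintro ⟨F, ε⟩ hε
  have hU : {x : Adjointable A E × Adjointable A E | x.2 - x.1 ∈ ball F ε} ∈
      uniformity (Adjointable A E) := by
    rw [uniformity_eq_comap_nhds_zero]
    exact preimage_mem_comap (nhds_zero_hasBasis.mem_of_mem (i := (F, ε)) hε)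
  obtain ⟨s, hs, hsU⟩ := (cauchy_iff.1 hl).2 _ hU
  filter_upwards [hs] with R hR p hp ξ
  -- `R` and `ξ` stay fixed while `R'` runs along the filter, so the bound for `R - R'` passes to `R
  -- - T`.
  have h1 : Tendsto (fun R' : Adjointable A E => bar p (R ξ - R' ξ)) l (𝓝 (bar p (R ξ - T ξ))) :=
    ((continuous_bar p).tendsto _).comp (tendsto_const_nhds.sub (hT ξ))
  refine le_of_tendsto h1 ?_
  filter_upwards [hs] with R' hR'
  exact hsU (Set.mk_mem_prod hR' hR) p hp ξ

end Complete

/-! ### Operator seminorms -/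

/-- A bound for a larger seminorm is one for a smaller seminorm. -/
theorem bound_of_le {p q : ContCStarSeminorm A} (hpq : q ≤ p) (T : Adjointable A E) {M : ℝ}
    (hM : 0 ≤ M) (h : ∀ ξ, bar p (T ξ) ≤ M * bar p ξ) (ξ : E) : bar q (T ξ) ≤ M * bar q ξ := by
  have hbar : ∀ ζ : E, bar q ζ ≤ bar p ζ := fun ζ => Real.sqrt_le_sqrt (hpq _)
  -- Cauchy–Schwarz gives `bar q (R ξ) ^ 2 ≤ bar q ξ * bar q (R² ξ)`, and iterating it reaches the
  -- power `R ^ 2 ^ n`. Only there is `bar q ≤ bar p` used, so the loss is one factor `bar p ξ` not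
  -- raised to any power. The factor `bar q ξ` on the left balances the exponents without a
  -- division.
  have hsa : ∀ (n : ℕ) (R : Adjointable A E) (N : ℝ), star R = R → 0 ≤ N →
      (∀ ζ, bar p (R ζ) ≤ N * bar p ζ) →
      bar q (R ξ) ^ 2 ^ n * bar q ξ ≤ bar q ξ ^ 2 ^ n * (N ^ 2 ^ n * bar p ξ) := by
    intro n
    induction n with
    | zero =>
      intro R N _ _ hR
      rw [pow_zero, pow_one, pow_one, pow_one, mul_comm]
      exact mul_le_mul_of_nonneg_left ((hbar _).trans (hR ξ)) (bar_nonneg q ξ)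
    | succ n ih =>
      intro R N hR hN hb
      have h1 := ih (R * R) (N * N) (by rw [star_mul, hR]) (mul_nonneg hN hN) fun ζ => by
        rw [mul_apply, mul_assoc]
        exact (hb _).trans (mul_le_mul_of_nonneg_left (hb ζ) hN)
      have h2 : bar q (R ξ) ^ 2 ≤ bar q ξ * bar q ((R * R) ξ) := by
        rw [bar_sq, inner_apply_left, hR]
        exact apply_inner_le q ξ _
      have h3 := pow_le_pow_left₀ (sq_nonneg _) h2 (2 ^ n)
      rw [← pow_mul, ← pow_succ', mul_pow] at h3
      calc bar q (R ξ) ^ 2 ^ (n + 1) * bar q ξ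
          ≤ bar q ξ ^ 2 ^ n * bar q ((R * R) ξ) ^ 2 ^ n * bar q ξ :=
            mul_le_mul_of_nonneg_right h3 (bar_nonneg q ξ)
        _ = bar q ξ ^ 2 ^ n * (bar q ((R * R) ξ) ^ 2 ^ n * bar q ξ) := by ring
        _ ≤ bar q ξ ^ 2 ^ n * (bar q ξ ^ 2 ^ n * ((N * N) ^ 2 ^ n * bar p ξ)) :=
            mul_le_mul_of_nonneg_left h1 (pow_nonneg (bar_nonneg q ξ) _)
        _ = _ := by rw [mul_pow]; ring
  have hstar : ∀ ζ, bar p (star T ζ) ≤ M * bar p ζ := fun ζ =>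
    star_mem_ball (F := {p}) hM (fun p' hp' => by rwa [Finset.mem_singleton.1 hp']) p
      (Finset.mem_singleton_self p) ζ
  have h1 : bar q (T ξ) ^ 2 ≤ bar q ξ * bar q ((star T * T) ξ) := by
    rw [bar_sq, inner_apply_left]
    exact apply_inner_le q ξ _
  rcases (bar_nonneg q ξ).eq_or_lt with h0 | h0
  · rw [← h0, zero_mul] at h1
    rw [← h0, mul_zero]
    exact (pow_eq_zero_iff two_ne_zero).1 (le_antisymm h1 (sq_nonneg _)) |>.le
  · have h2 : bar q ((star T * T) ξ) ≤ bar q ξ * (M * M) := by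
      -- The constant depends on `ξ` but not on `n`, so it disappears after taking roots.
      refine le_of_forall_pow_two_pow_le (C := bar p ξ / bar q ξ) (by positivity) fun n => ?_
      have h3 := hsa n (star T * T) (M * M) (by rw [star_mul, star_star]) (mul_nonneg hM hM)
        fun ζ => by
          rw [mul_apply, mul_assoc]
          exact (hstar _).trans (mul_le_mul_of_nonneg_left (h ζ) hM)
      rw [div_mul_eq_mul_div, le_div_iff₀ h0]
      refine h3.trans (le_of_eq ?_)
      ring
    refine le_of_sq_le_sq ?_ (mul_nonneg hM h0.le)
    nlinarith

/-- The operator seminorm attached to `p` (relevant for operators bounded with respect to `p`). -/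
noncomputable def opNorm (p : ContCStarSeminorm A) (T : Adjointable A E) : ℝ :=
  sInf {M | 0 ≤ M ∧ ∀ ξ, bar p (T ξ) ≤ M * bar p ξ}

theorem opNorm_nonneg (p : ContCStarSeminorm A) (T : Adjointable A E) : 0 ≤ opNorm p T :=
  Real.sInf_nonneg fun _ h => h.1

theorem opNorm_le {p : ContCStarSeminorm A} {T : Adjointable A E} {M : ℝ} (hM : 0 ≤ M)
    (h : ∀ ξ, bar p (T ξ) ≤ M * bar p ξ) : opNorm p T ≤ M :=
  csInf_le ⟨0, fun _ h => h.1⟩ ⟨hM, h⟩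

/-- Membership in `K(E)` makes the set of bounds nonempty, since `T` is close to a finite rank
operator; its infimum is then a bound as well. Where `bar p ξ = 0`, any bound forces `bar p (T ξ) =
0`. -/
theorem bar_apply_le_opNorm (p : ContCStarSeminorm A) {T : Adjointable A E} (hT : T ∈ Compact A E)
    (ξ : E) : bar p (T ξ) ≤ opNorm p T * bar p ξ := by
  obtain ⟨M, hM, h⟩ := exists_bound_of_mem_closure p hT
  rcases (bar_nonneg p ξ).eq_or_lt with h0 | h0
  · have := h ξ
    rw [← h0, mul_zero] at this ⊢
    exact this
  · rw [← div_le_iff₀ h0]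
    exact le_csInf ⟨M, hM, h⟩ fun N hN => (div_le_iff₀ h0).2 (hN.2 ξ)

/-- By `bound_of_le`, one seminorm that dominates `F` controls all the operator bounds attached to
`F`. -/
theorem mem_ball_of_opNorm_le {p : ContCStarSeminorm A} {F : Finset (ContCStarSeminorm A)}
    (hF : ∀ q ∈ F, q ≤ p) {T : Adjointable A E} (hT : T ∈ Compact A E) {ε : ℝ}
    (h : opNorm p T ≤ ε) : T ∈ ball F ε := fun q hq ξ =>
  bound_of_le (hF q hq) T ((opNorm_nonneg p T).trans h) (fun η =>
    (bar_apply_le_opNorm p hT η).trans (mul_le_mul_of_nonneg_right h (bar_nonneg p η))) ξ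

theorem opNorm_le_of_mem_ball {p : ContCStarSeminorm A} {T : Adjointable A E} {ε : ℝ}
    (hε : 0 ≤ ε) (h : T ∈ ball {p} ε) : opNorm p T ≤ ε :=
  opNorm_le hε (h p (Finset.mem_singleton_self p))

theorem opNorm_star_le (p : ContCStarSeminorm A) {T : Adjointable A E} (hT : T ∈ Compact A E) :
    opNorm p (star T) ≤ opNorm p T :=
  opNorm_le_of_mem_ball (opNorm_nonneg p T) (star_mem_ball (opNorm_nonneg p T)
    (mem_ball_of_opNorm_le (p := p) (by simp) hT le_rfl))

theorem opNorm_mul_le (p : ContCStarSeminorm A) {T S : Adjointable A E} (hT : T ∈ Compact A E)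
    (hS : S ∈ Compact A E) : opNorm p (T * S) ≤ opNorm p T * opNorm p S :=
  opNorm_le (mul_nonneg (opNorm_nonneg p T) (opNorm_nonneg p S)) fun ξ => by
    rw [mul_apply, mul_assoc]
    exact (bar_apply_le_opNorm p hT _).trans
      (mul_le_mul_of_nonneg_left (bar_apply_le_opNorm p hS ξ) (opNorm_nonneg p T))

theorem opNorm_add_le (p : ContCStarSeminorm A) {T S : Adjointable A E} (hT : T ∈ Compact A E)
    (hS : S ∈ Compact A E) : opNorm p (T + S) ≤ opNorm p T + opNorm p S :=
  opNorm_le (add_nonneg (opNorm_nonneg p T) (opNorm_nonneg p S)) fun ξ => by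
    rw [add_apply, add_mul]
    exact (bar_add_le p _ _).trans
      (add_le_add (bar_apply_le_opNorm p hT ξ) (bar_apply_le_opNorm p hS ξ))

theorem opNorm_smul_le (p : ContCStarSeminorm A) (c : ℂ) {T : Adjointable A E}
    (hT : T ∈ Compact A E) : opNorm p (c • T) ≤ ‖c‖ * opNorm p T :=
  opNorm_le (mul_nonneg (norm_nonneg c) (opNorm_nonneg p T)) fun ξ => by
    rw [smul_apply, bar_smul, mul_assoc]
    exact mul_le_mul_of_nonneg_left (bar_apply_le_opNorm p hT ξ) (norm_nonneg c)

theorem opNorm_zero (p : ContCStarSeminorm A) : opNorm p (0 : Adjointable A E) = 0 :=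
  le_antisymm (opNorm_le le_rfl fun ξ => by rw [zero_apply, bar_zero, zero_mul])
    (opNorm_nonneg p 0)

/-- The nontrivial inequality is Cauchy–Schwarz applied to `bar p (T ξ) ^ 2 = p ⟨ξ, T⋆T ξ⟩`. -/
theorem opNorm_star_mul_self (p : ContCStarSeminorm A) {T : Adjointable A E}
    (hT : T ∈ Compact A E) : opNorm p (star T * T) = opNorm p T ^ 2 := by
  have hT' : star T ∈ Compact A E := star_mem hT
  refine le_antisymm ?_ ?_
  · rw [sq]
    exact (opNorm_mul_le p hT' hT).trans
      (mul_le_mul_of_nonneg_right (opNorm_star_le p hT) (opNorm_nonneg p T))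
  · rw [← Real.le_sqrt (opNorm_nonneg p T) (opNorm_nonneg p _)]
    refine opNorm_le (Real.sqrt_nonneg _) fun ξ => ?_
    refine le_of_sq_le_sq ?_ (mul_nonneg (Real.sqrt_nonneg _) (bar_nonneg p ξ))
    rw [mul_pow, Real.sq_sqrt (opNorm_nonneg p _), bar_sq, inner_apply_left]
    have h1 := bar_apply_le_opNorm p (mul_mem hT' hT) ξ
    have h2 := apply_inner_le p ξ ((star T * T) ξ)
    refine h2.trans ?_
    rw [sq, mul_left_comm]
    exact mul_le_mul_of_nonneg_left h1 (bar_nonneg p ξ)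

end Adjointable

end HilbertModule

/-! ### The algebra of compact operators is a locally C⋆-algebra -/

namespace HilbertModule

section CompactOperators

open Adjointable

variable (A E : Type*) [NonUnitalRing A] [StarRing A] [Module ℂ A] [UniformSpace A]
  [AddCommGroup E] [Module ℂ E] [UniformSpace E] [HilbertModule A E] [IsLocallyCStarAlgebra A]

namespace Compact

/-- The ring structure of `K(E)`. -/
@[reducible] noncomputable def nonUnitalRing : NonUnitalRing (Compact A E) := inferInstance

/-- The involution of `K(E)`. -/
@[reducible] noncomputable def starRing : StarRing (Compact A E) := inferInstance

/-- The vector space structure of `K(E)`. -/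
@[reducible] noncomputable def module : Module ℂ (Compact A E) := inferInstance

/-- The scalar multiplication of `K(E)`. -/
@[reducible] noncomputable def smul : SMul ℂ (Compact A E) :=
  (module A E).toDistribMulAction.toDistribSMul.toSMul

/-- The uniform structure of `K(E)`. -/
@[reducible] noncomputable def uniformSpace : UniformSpace (Compact A E) :=
  letI := Adjointable.uniformSpace A E
  instUniformSpaceSubtype

attribute [local instance] nonUnitalRing starRing module smul

/-- The inclusion of `K(E)` into `L(E)`. -/
def inclusion : Compact A E →ₗ[ℂ] Adjointable A E where
  toFun T := T.1
  map_add' _ _ := rfl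
  map_smul' _ _ := rfl

theorem isInducing_inclusion : IsInducing (inclusion A E) := IsInducing.subtypeVal

theorem isTopologicalAddGroup : IsTopologicalAddGroup (Compact A E) :=
  (isInducing_inclusion A E).topologicalAddGroup (inclusion A E)

attribute [local instance] isTopologicalAddGroup

theorem isScalarTower : IsScalarTower ℂ (Compact A E) (Compact A E) :=
  ⟨fun c T S => Subtype.ext (smul_mul_assoc c T.1 S.1)⟩

theorem smulCommClass : SMulCommClass ℂ (Compact A E) (Compact A E) :=
  ⟨fun c T S => Subtype.ext (mul_smul_comm c T.1 S.1).symm⟩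

theorem starModule : StarModule ℂ (Compact A E) :=
  ⟨fun c T => Subtype.ext (star_smul c T.1)⟩

theorem t2Space : T2Space (Compact A E) := by
  have := Adjointable.t2Space (A := A) (E := E)
  exact IsEmbedding.subtypeVal.t2Space

variable {A E}

theorem nhds_zero_hasBasis : (𝓝 (0 : Compact A E)).HasBasis
    (fun i : Finset (ContCStarSeminorm A) × ℝ => 0 < i.2) fun i => {T | T.1 ∈ ball i.1 i.2} := by
  rw [(isInducing_inclusion A E).nhds_eq_comap, _root_.map_zero]
  exact Adjointable.nhds_zero_hasBasis.comap _

/-- The C⋆-seminorm on `K(E)` attached to a continuous C⋆-seminorm on `A`. -/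
noncomputable def seminorm (p : ContCStarSeminorm A) : ContCStarSeminorm (Compact A E) where
  toSeminorm := Seminorm.ofSMulLE (fun T => opNorm p T.1) (opNorm_zero p)
    (fun T S => opNorm_add_le p T.2 S.2) fun c T => opNorm_smul_le p c T.2
  mul_le' T S := opNorm_mul_le p T.2 S.2
  star_mul_self' T := opNorm_star_mul_self p T.2
  continuous' := by
    refine Seminorm.continuous_of_continuousAt_zero
      (p := Seminorm.ofSMulLE (fun T : Compact A E => opNorm p T.1) (opNorm_zero p)
        (fun T S => opNorm_add_le p T.2 S.2) fun c T => opNorm_smul_le p c T.2) ?_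
    change Tendsto (fun T : Compact A E => opNorm p T.1) (𝓝 0) (𝓝 (opNorm p (0 : Adjointable A E)))
    rw [opNorm_zero, (nhds_zero_hasBasis (A := A) (E := E)).tendsto_iff Metric.nhds_basis_closedBall]
    refine fun ε hε => ⟨({p}, ε), hε, fun T hT => ?_⟩
    rw [mem_closedBall_zero_iff]
    exact (Real.norm_of_nonneg (opNorm_nonneg p T.1)).trans_le (opNorm_le_of_mem_ball hε.le hT)

theorem seminorm_apply (p : ContCStarSeminorm A) (T : Compact A E) :
    seminorm p T = opNorm p T.1 := rfl

variable (A E) in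
-- Completeness holds because `K(E)` is closed in `L(E)`. The C⋆-seminorms `seminorm p` generate the
-- topology, and every other continuous C⋆-seminorm adds nothing to it. The general results on
-- actions thereby apply to `K(E)`.
theorem isLocallyCStarAlgebra :
    @IsLocallyCStarAlgebra (Compact A E) _ _ _ (uniformSpace A E) := by
  let _ := Adjointable.uniformSpace A E
  have h1 : IsUniformAddGroup (Adjointable A E) := Adjointable.isUniformAddGroup
  have h2 : CompleteSpace (Adjointable A E) := Adjointable.completeSpace
  let _ := uniformSpace A E
  have h3 : IsUniformAddGroup (Compact A E) := IsUniformAddGroup.comap (inclusion A E)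
  have h4 : IsClosed {T | T ∈ Compact A E} :=
    isClosed_closure (s := (finiteRank A E : Set (Adjointable A E)))
  have h5 : CompleteSpace (Compact A E) := h4.completeSpace_coe
  have h6 := isScalarTower A E
  have h7 := smulCommClass A E
  have h8 := starModule A E
  have h9 := t2Space A E
  refine { nhds_zero := le_antisymm (le_iInf fun q => ?_) ?_ }
  · exact tendsto_iff_comap.1 q.tendsto_zero
  · rw [nhds_zero_hasBasis.ge_iff]
    rintro ⟨F, ε⟩ hε
    have : ∀ p ∈ F, {T : Compact A E | seminorm p T < ε} ∈
        ⨅ q : ContCStarSeminorm (Compact A E), comap q (𝓝 0) := fun p _ =>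
      mem_iInf_of_mem (seminorm p) (preimage_mem_comap (Iio_mem_nhds hε))
    filter_upwards [(Filter.biInter_finset_mem F).2 this] with T hT p hp
    have h := Set.mem_iInter₂.1 hT p hp
    exact mem_ball_of_opNorm_le (p := p) (F := {p}) (by simp) T.2 (le_of_lt h) p
      (Finset.mem_singleton_self p)

variable (A E) in
theorem dense_span_theta :
    Dense (Submodule.span ℂ (Set.range fun x : E × E => theta A x.1 x.2) : Set (Compact A E)) := by
  intro T
  rw [(isInducing_inclusion A E).closure_eq_preimage_closure_image, ← Submodule.map_coe,
    Submodule.map_span, ← Set.range_comp]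
  exact T.2

/-- The difference is `θ_{f x - ξ, h x} + θ_{ξ, h x - η}`, and `θ_{ξ,η}` has the `p`-bound `bar p ξ
* bar p η`. The factor `bar p (h x)` converges, so both terms tend to zero. -/
theorem tendsto_theta {X : Type*} {l : Filter X} {f h : X → E} {ξ η : E}
    (hf : Tendsto f l (𝓝 ξ)) (hh : Tendsto h l (𝓝 η)) :
    Tendsto (fun x => theta A (f x) (h x)) l (𝓝 (theta A ξ η)) := by
  let _ := uniformSpace A E
  have := isLocallyCStarAlgebra A E
  rw [← nhds_translation_sub, tendsto_comap_iff, nhds_zero_hasBasis.tendsto_right_iff]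
  rintro ⟨F, ε⟩ hε
  have key : ∀ p ∈ F, ∀ᶠ x in l, ∀ ζ, bar p ((theta A (f x) (h x) - theta A ξ η : Compact A E).1 ζ)
      ≤ ε * bar p ζ := fun p _ => by
    have h1 := (((tendsto_iff A).1 hf p).mul (((continuous_bar p).tendsto η).comp hh)).add
      (((tendsto_iff A).1 hh p).const_mul (bar p ξ))
    rw [zero_mul, mul_zero, add_zero] at h1
    filter_upwards [h1.eventually_le_const hε] with x hx ζ
    have h2 : (theta A (f x) (h x) - theta A ξ η : Compact A E).1 ζ =
        (rankOne (f x - ξ) (h x) : Adjointable A E) ζ +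
          (rankOne ξ (h x - η) : Adjointable A E) ζ := by
      change rmul (f x) (inner A (h x) ζ) - rmul ξ (inner A η ζ) = _
      have h3 : inner A (h x) ζ = inner A (h x - η) ζ + inner A η ζ := by
        rw [← inner_add_left, sub_add_cancel]
      have h4 : rmul ξ (inner A (h x) ζ) = rmul ξ (inner A (h x - η) ζ) + rmul ξ (inner A η ζ) := by
        rw [← rmul_add, ← h3]
      rw [rankOne_apply, rankOne_apply, sub_rmul, h4]
      abel
    rw [h2]
    refine (bar_add_le p _ _).trans (le_trans (add_le_add
      ((bar_rmul_le p (f x - ξ) _).trans (mul_le_mul_of_nonneg_left (apply_inner_le p (h x) ζ)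
        (bar_nonneg p _)))
      ((bar_rmul_le p ξ _).trans (mul_le_mul_of_nonneg_left (apply_inner_le p (h x - η) ζ)
        (bar_nonneg p _)))) ?_)
    rw [← mul_assoc, ← mul_assoc, ← add_mul]
    exact mul_le_mul_of_nonneg_right hx (bar_nonneg p ζ)
  filter_upwards [(Filter.eventually_all_finset F).2 key] with x hx
  exact hx

end Compact

end CompactOperators

end HilbertModule

/-! ### Automorphisms of Hilbert modules -/

namespace HilbertAut

open HilbertModule

variable {A E : Type*} [NonUnitalRing A] [StarRing A] [Module ℂ A] [UniformSpace A]
  [AddCommGroup E] [Module ℂ E] [UniformSpace E] [HilbertModule A E]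

theorem exists_hom (u : HilbertAut A E) : ∃ φ : A →⋆ₙₐ[ℂ] A, Continuous φ ∧
    ∀ ξ η : E, inner A (u.1 ξ) (u.1 η) = φ (inner A ξ η) := u.2.1

theorem apply_inv_apply (u : HilbertAut A E) (ξ : E) : u.1 ((u⁻¹).1 ξ) = ξ :=
  u.1.apply_symm_apply ξ

theorem inv_apply_apply (u : HilbertAut A E) (ξ : E) : (u⁻¹).1 (u.1 ξ) = ξ :=
  u.1.symm_apply_apply ξ

/-- The inverse of `u` serves as its adjoint, up to the twist by `φ`. Linearity of `u` and
adjointability of conjugates follow from this rule. -/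
theorem inner_apply_left {u : HilbertAut A E} {φ : A →⋆ₙₐ[ℂ] A}
    (h : ∀ ξ η : E, inner A (u.1 ξ) (u.1 η) = φ (inner A ξ η)) (ξ η : E) :
    inner A (u.1 ξ) η = φ (inner A ξ ((u⁻¹).1 η)) := by
  rw [← h, apply_inv_apply]

theorem inner_apply_right {u : HilbertAut A E} {φ : A →⋆ₙₐ[ℂ] A}
    (h : ∀ ξ η : E, inner A (u.1 ξ) (u.1 η) = φ (inner A ξ η)) (ξ η : E) :
    inner A ξ (u.1 η) = φ (inner A ((u⁻¹).1 ξ) η) := by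
  rw [← h, apply_inv_apply]

/-- Automorphisms of Hilbert modules are linear. -/
noncomputable def linearMap (u : HilbertAut A E) : E →ₗ[ℂ] E where
  toFun := u.1
  map_add' ξ η := by
    obtain ⟨φ, -, h⟩ := exists_hom u
    -- Moving `u` to the other side leaves `φ` of an inner product that is additive in the second
    -- variable.
    refine ext_inner_left A fun ζ => ?_
    rw [HilbertModule.inner_add_right, inner_apply_right h, inner_apply_right h,
      inner_apply_right h, HilbertModule.inner_add_right, map_add]
  map_smul' c ξ := by
    obtain ⟨φ, -, h⟩ := exists_hom u
    refine ext_inner_left A fun ζ => ?_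
    rw [RingHom.id_apply, HilbertModule.inner_smul_right, inner_apply_right h,
      inner_apply_right h, HilbertModule.inner_smul_right, map_smul]

theorem apply_rmul {u : HilbertAut A E} {φ : A →⋆ₙₐ[ℂ] A}
    (h : ∀ ξ η : E, inner A (u.1 ξ) (u.1 η) = φ (inner A ξ η)) (ξ : E) (a : A) :
    u.1 (rmul ξ a) = rmul (u.1 ξ) (φ a) := by
  refine ext_inner_left A fun ζ => ?_
  rw [inner_rmul_right, inner_apply_right h, inner_apply_right h, inner_rmul_right, map_mul]

theorem bar_apply {u : HilbertAut A E} {φ : A →⋆ₙₐ[ℂ] A} (hφ : Continuous φ)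
    (h : ∀ ξ η : E, inner A (u.1 ξ) (u.1 η) = φ (inner A ξ η)) (p : ContCStarSeminorm A) (ξ : E) :
    bar p (u.1 ξ) = bar (p.comp φ hφ) ξ := by
  rw [bar, h]; rfl

/-! #### The induced automorphism of `A` -/

/-- The endomorphism of `A` belonging to an automorphism of `E`. -/
noncomputable def hom (u : HilbertAut A E) : A →⋆ₙₐ[ℂ] A := (exists_hom u).choose

theorem continuous_hom (u : HilbertAut A E) : Continuous (hom u) := (exists_hom u).choose_spec.1

theorem hom_inner (u : HilbertAut A E) (ξ η : E) :
    hom u (inner A ξ η) = inner A (u.1 ξ) (u.1 η) := ((exists_hom u).choose_spec.2 ξ η).symm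

variable [IsLocallyCStarAlgebra A]

/-- Fullness is used here: agreement on inner products extends to their dense span and then to `A`.
Hence the chosen `hom u` are multiplicative in `u` despite the choice. -/
theorem hom_eq_of_forall_inner (hE : IsFull A E) {φ ψ : A →⋆ₙₐ[ℂ] A} (hφ : Continuous φ)
    (hψ : Continuous ψ) (h : ∀ ξ η : E, φ (inner A ξ η) = ψ (inner A ξ η)) (a : A) :
    φ a = ψ a := by
  refine congrFun (Continuous.ext_on hE hφ hψ ?_) a
  exact LinearMap.eqOn_span (f := (φ : A →ₗ[ℂ] A)) (g := (ψ : A →ₗ[ℂ] A)) (by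
    rintro _ ⟨x, rfl⟩
    exact h _ _)

theorem hom_mul (hE : IsFull A E) (u v : HilbertAut A E) (a : A) :
    hom (u * v) a = hom u (hom v a) :=
  hom_eq_of_forall_inner hE (φ := hom (u * v)) (ψ := (hom u).comp (hom v)) (continuous_hom _)
    ((continuous_hom u).comp (continuous_hom v))
    (fun ξ η => by
      rw [NonUnitalStarAlgHom.comp_apply, hom_inner, hom_inner, hom_inner]; rfl) a

theorem hom_one (hE : IsFull A E) (a : A) : hom (1 : HilbertAut A E) a = a :=
  hom_eq_of_forall_inner hE (φ := hom 1) (ψ := NonUnitalStarAlgHom.id ℂ A) (continuous_hom _)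
    continuous_id (fun _ _ => hom_inner _ _ _) a

/-- The action of `Aut(E)` on `A`. -/
noncomputable def toContStarAut (hE : IsFull A E) : HilbertAut A E →* ContStarAut A where
  toFun u :=
    ⟨{ toFun := hom u
       invFun := hom u⁻¹
       left_inv := fun a => by rw [← hom_mul hE, inv_mul_cancel, hom_one hE]
       right_inv := fun a => by rw [← hom_mul hE, mul_inv_cancel, hom_one hE]
       map_mul' := map_mul (hom u)
       map_add' := map_add (hom u)
       map_star' := map_star (hom u)
       map_smul' := map_smul (hom u) }, continuous_hom u, continuous_hom u⁻¹⟩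
  map_one' := Subtype.ext (StarAlgEquiv.ext (hom_one hE))
  map_mul' u v := Subtype.ext (StarAlgEquiv.ext (hom_mul hE u v))

theorem toContStarAut_inner (hE : IsFull A E) (u : HilbertAut A E) (ξ η : E) :
    (toContStarAut hE u).1 (inner A ξ η) = inner A (u.1 ξ) (u.1 η) := hom_inner u ξ η

/-! #### The induced automorphism of `K(E)` -/

/-- Conjugation of an operator by an automorphism of `E`. -/
noncomputable def conj (u : HilbertAut A E) (T : Adjointable A E) : Adjointable A E :=
  Adjointable.ofAdjointPair ((linearMap u).comp (T.1.comp (linearMap u⁻¹)))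
    ((linearMap u).comp ((star T).1.comp (linearMap u⁻¹))) fun ξ η => by
      obtain ⟨φ, -, h⟩ := exists_hom u
      change inner A (u.1 (T ((u⁻¹).1 ξ))) η = inner A ξ (u.1 (star T ((u⁻¹).1 η)))
      rw [inner_apply_left h, inner_apply_right h, Adjointable.inner_apply_left]

theorem conj_apply (u : HilbertAut A E) (T : Adjointable A E) (ξ : E) :
    conj u T ξ = u.1 (T ((u⁻¹).1 ξ)) := rfl

theorem conj_star (u : HilbertAut A E) (T : Adjointable A E) :
    conj u (star T) = star (conj u T) := by
  obtain ⟨φ, -, h⟩ := exists_hom u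
  ext ξ
  refine ext_inner_left A fun ζ => ?_
  rw [← Adjointable.inner_apply_left, conj_apply, conj_apply, inner_apply_left h,
    inner_apply_right h, Adjointable.inner_apply_left]

theorem conj_one (T : Adjointable A E) : conj 1 T = T := rfl

theorem conj_conj (u v : HilbertAut A E) (T : Adjointable A E) :
    conj (u * v) T = conj u (conj v T) := by
  ext ξ
  simp only [conj_apply, mul_inv_rev]
  rfl

theorem conj_mul (u : HilbertAut A E) (T S : Adjointable A E) :
    conj u (T * S) = conj u T * conj u S := by
  ext ξ
  simp only [conj_apply, Adjointable.mul_apply, inv_apply_apply]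

/-- Conjugation by an automorphism of `E` as a linear map. -/
noncomputable def conjLinear (u : HilbertAut A E) : Adjointable A E →ₗ[ℂ] Adjointable A E where
  toFun := conj u
  map_add' _ _ := Adjointable.ext fun _ => (linearMap u).map_add _ _
  map_smul' c _ := Adjointable.ext fun _ => (linearMap u).map_smul c _

theorem conj_rankOne (u : HilbertAut A E) (ξ η : E) :
    conj u (Adjointable.rankOne ξ η) = Adjointable.rankOne (u.1 ξ) (u.1 η) := by
  obtain ⟨φ, -, h⟩ := exists_hom u
  ext ζ
  rw [conj_apply, Adjointable.rankOne_apply, Adjointable.rankOne_apply, apply_rmul h,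
    inner_apply_left h]

/-- Since `bar p (u ξ) = bar (p ∘ φ) ξ`, a bound for `T` with respect to `p ∘ φ` is the same bound
for its conjugate with respect to `p`. -/
theorem continuous_conj (u : HilbertAut A E) : Continuous (conj u) := by
  classical
  obtain ⟨φ, hφ, h⟩ := exists_hom u
  refine continuous_of_continuousAt_zero (conjLinear u) ?_
  rw [ContinuousAt, map_zero,
    Adjointable.nhds_zero_hasBasis.tendsto_iff Adjointable.nhds_zero_hasBasis]
  rintro ⟨F, ε⟩ hε
  refine ⟨(F.image fun p => p.comp φ hφ, ε), hε, fun T hT p hp ξ => ?_⟩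
  have h1 := hT _ (Finset.mem_image_of_mem _ hp) ((u⁻¹).1 ξ)
  rwa [← bar_apply hφ h, ← bar_apply hφ h, apply_inv_apply] at h1

theorem conj_mem_compact (u : HilbertAut A E) {T : Adjointable A E} (hT : T ∈ Compact A E) :
    conj u T ∈ Compact A E := by
  refine map_mem_closure (continuous_conj u) hT fun S hS => ?_
  have h1 : (Adjointable.finiteRank A E).map (conjLinear u) ≤ Adjointable.finiteRank A E := by
    rw [Adjointable.finiteRank, Submodule.map_span, Submodule.span_le]
    rintro _ ⟨_, ⟨x, rfl⟩, rfl⟩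
    exact Submodule.subset_span ⟨(u.1 x.1, u.1 x.2), (conj_rankOne u x.1 x.2).symm⟩
  exact h1 (Submodule.mem_map_of_mem hS)

/-- Conjugation of compact operators by an automorphism of `E`. -/
noncomputable def conjCompact (u : HilbertAut A E) (T : Compact A E) : Compact A E :=
  ⟨conj u T.1, conj_mem_compact u T.2⟩

theorem conjCompact_mul (u v : HilbertAut A E) (T : Compact A E) :
    conjCompact (u * v) T = conjCompact u (conjCompact v T) := Subtype.ext (conj_conj u v T.1)

theorem conjCompact_one (T : Compact A E) : conjCompact 1 T = T := rfl

theorem continuous_conjCompact (u : HilbertAut A E) :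
    Continuous (conjCompact u : Compact A E → Compact A E) :=
  ((continuous_conj u).comp continuous_subtype_val).subtype_mk _

attribute [local instance] Compact.nonUnitalRing Compact.starRing Compact.module Compact.smul

variable (A E) in
/-- The action of `Aut(E)` on `K(E)`. -/
noncomputable def toContStarAutCompact : HilbertAut A E →* ContStarAut (Compact A E) where
  toFun u :=
    ⟨{ toFun := conjCompact u
       invFun := conjCompact u⁻¹
       left_inv := fun T => by rw [← conjCompact_mul, inv_mul_cancel, conjCompact_one]
       right_inv := fun T => by rw [← conjCompact_mul, mul_inv_cancel, conjCompact_one]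
       map_mul' := fun T S => Subtype.ext (conj_mul u T.1 S.1)
       map_add' := fun T S => Subtype.ext ((conjLinear u).map_add T.1 S.1)
       map_star' := fun T => Subtype.ext (conj_star u T.1)
       map_smul' := fun c T => Subtype.ext ((conjLinear u).map_smul c T.1) },
      continuous_conjCompact u, continuous_conjCompact u⁻¹⟩
  map_one' := rfl
  map_mul' u v := Subtype.ext (StarAlgEquiv.ext (conjCompact_mul u v))

theorem toContStarAutCompact_theta (u : HilbertAut A E) (ξ η : E) :
    (toContStarAutCompact A E u).1 (theta A ξ η) = theta A (u.1 ξ) (u.1 η) :=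
  Subtype.ext (conj_rankOne u ξ η)

end HilbertAut

/-! ### The induced actions -/

theorem ContStarAut.ext_of_dense_span {A : Type*} [NonUnitalRing A] [StarRing A] [Module ℂ A]
    [TopologicalSpace A] [T2Space A] {s : Set A} (hs : Dense (Submodule.span ℂ s : Set A))
    {φ ψ : ContStarAut A} (h : ∀ a ∈ s, φ.1 a = ψ.1 a) : φ = ψ := by
  refine Subtype.ext (StarAlgEquiv.ext fun a => ?_)
  refine congrFun (Continuous.ext_on hs φ.2.1 ψ.2.1 fun b hb => ?_) a
  induction hb using Submodule.span_induction with
  | mem b hb => exact h b hb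
  | zero => rw [map_zero, map_zero]
  | add b c _ _ hb hc => rw [map_add, map_add, hb, hc]
  | smul c b _ hb => rw [map_smul, map_smul, hb]

/-! ### The seminorms attached to an inverse limit presentation -/

namespace CStarSystem.Limit

variable {Λ : Type*} [Preorder Λ] {S : CStarSystem Λ} {A : Type*} [NonUnitalRing A] [StarRing A]
  [Module ℂ A] [TopologicalSpace A] (P : S.Limit A)

theorem continuous_proj (i : Λ) : Continuous (P.proj i) :=
  (continuous_apply i).comp P.isInducing.continuous

/-- The C⋆-seminorm on an inverse limit of C⋆-algebras which belongs to an index. -/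
noncomputable def seminorm (i : Λ) : ContCStarSeminorm A :=
  (ContCStarSeminorm.ofNorm (S.alg i)).comp (P.proj i) (P.continuous_proj i)

theorem seminorm_mono : Monotone P.seminorm := fun i j h a => by
  change ‖P.proj i a‖ ≤ ‖P.proj j a‖
  rw [← P.map_proj h]
  exact NonUnitalStarAlgHom.norm_apply_le (S.map h) _

/-- The seminorms belonging to the indices are cofinal. -/
theorem exists_le_seminorm [IsDirectedOrder Λ] [Nonempty Λ] (q : ContCStarSeminorm A) :
    ∃ i, q ≤ P.seminorm i := by
  have h1 : 𝓝 (0 : A) = ⨅ i, comap (P.proj i) (𝓝 0) := by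
    rw [P.isInducing.nhds_eq_comap, nhds_pi, Filter.pi, comap_iInf]
    refine iInf_congr fun i => ?_
    rw [comap_comap, map_zero]
    rfl
  have h2 : ∀ i, comap (P.proj i) (𝓝 0) = comap (P.seminorm i) (𝓝 0) := fun i => by
    rw [← comap_norm_nhds_zero, comap_comap]
    rfl
  have h3 : {a | q a < 1} ∈ 𝓝 (0 : A) := q.tendsto_zero (Iio_mem_nhds one_pos)
  simp only [h1, h2] at h3
  have hanti : Antitone fun i => comap (P.seminorm i) (𝓝 0) := fun i j h =>
    tendsto_iff_comap.1
      (squeeze_zero (fun a => apply_nonneg _ a) (P.seminorm_mono h) tendsto_comap)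
  -- Directedness of the index set allows a single index in place of finitely many.
  obtain ⟨i, hi⟩ := (mem_iInf_of_directed hanti.directed_ge _).1 h3
  obtain ⟨ε, hε, h⟩ := (Metric.nhds_basis_ball.comap (P.seminorm i)).mem_iff.1 hi
  refine ⟨i, ContCStarSeminorm.le_of_forall_lt hε fun a ha => h ?_⟩
  rw [Set.mem_preimage, mem_ball_zero_iff, Real.norm_of_nonneg (apply_nonneg _ a)]
  exact ha

end CStarSystem.Limit

/-! ### The induced action on `A` -/

namespace HilbertAut

open HilbertModule

variable {G : Type*} [Group G] {A E : Type*}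
  [NonUnitalRing A] [StarRing A] [Module ℂ A] [UniformSpace A] [IsLocallyCStarAlgebra A]
  [AddCommGroup E] [Module ℂ E] [UniformSpace E] [HilbertModule A E]
  {u : G →* HilbertAut A E}

theorem eq_toContStarAut (hE : IsFull A E) {α : G →* ContStarAut A}
    (hα : ∀ (g : G) (ξ η : E), (α g).1 (inner A ξ η) = inner A ((u g).1 ξ) ((u g).1 η)) :
    α = (toContStarAut hE).comp u := by
  refine MonoidHom.ext fun g => ContStarAut.ext_of_dense_span hE ?_
  rintro _ ⟨x, rfl⟩
  exact (hα g x.1 x.2).trans (hom_inner (u g) x.1 x.2).symm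

/-- The automorphism of `E_i` comes with some ⋆-homomorphism `φ` of `A_i`. It matches `hom v` under
the projection on inner products, hence on all of `A` by fullness of `E`, and ⋆-homomorphisms of
C⋆-algebras are contractive. Fullness of `E_i` is not assumed, so `φ` need not be unique or
invertible. -/
theorem norm_proj_toContStarAut_le (hE : IsFull A E) {Λ : Type*} [Preorder Λ]
    {S : HilbertSystem Λ} (P : S.Limit A E) {v : HilbertAut A E} {i : Λ}
    {v' : HilbertAut (S.alg i) (S.mod i)}
    (h : ∀ ξ : E, P.mproj i (v.1 ξ) = v'.1 (P.mproj i ξ)) (a : A) :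
    ‖P.algLimit.proj i ((toContStarAut hE v).1 a)‖ ≤ ‖P.algLimit.proj i a‖ := by
  obtain ⟨φ, hφ, hv'⟩ := exists_hom v'
  have key : ∀ a, (P.algLimit.proj i).comp (hom v) a = φ.comp (P.algLimit.proj i) a := by
    refine congrFun (Continuous.ext_on hE
      ((P.algLimit.continuous_proj i).comp (continuous_hom v))
      (hφ.comp (P.algLimit.continuous_proj i)) ?_)
    refine LinearMap.eqOn_span (f := ((P.algLimit.proj i).comp (hom v) : A →ₗ[ℂ] S.alg i))
      (g := (φ.comp (P.algLimit.proj i) : A →ₗ[ℂ] S.alg i)) ?_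
    rintro _ ⟨x, rfl⟩
    change P.algLimit.proj i (hom v (inner A x.1 x.2)) = φ (P.algLimit.proj i (inner A x.1 x.2))
    rw [hom_inner, ← P.inner_mproj, ← P.inner_mproj, h, h, hv']
  have h1 : P.algLimit.proj i ((toContStarAut hE v).1 a) = φ (P.algLimit.proj i a) := key a
  rw [h1]
  exact NonUnitalStarAlgHom.norm_apply_le φ _

theorem hasCofinalInvariantSeminorms (hE : IsFull A E)
    (hu : IsInverseLimitAction.{w, v, x} u) :
    ContStarAut.HasCofinalInvariantSeminorms ((toContStarAut hE).comp u) := by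
  obtain ⟨Λ, _, _, _, S, P, u', -, hu'⟩ := hu
  intro q
  obtain ⟨i, hi⟩ := P.algLimit.exists_le_seminorm q
  refine ⟨P.algLimit.seminorm i, fun g a => ?_, hi⟩
  have hle : ∀ (g : G) (a : A), P.algLimit.seminorm i ((toContStarAut hE (u g)).1 a) ≤
      P.algLimit.seminorm i a := fun g a =>
    norm_proj_toContStarAut_le hE P (v := u g) (v' := u' i g) (hu' g i) a
  refine le_antisymm (hle g a) ?_
  -- The inequality for `g⁻¹` gives the reverse one for `g`, hence invariance.
  have h1 := hle g⁻¹ ((toContStarAut hE (u g)).1 a)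
  have h2 : (toContStarAut hE (u g⁻¹)).1 ((toContStarAut hE (u g)).1 a) = a := by
    change hom (u g⁻¹) (hom (u g) a) = a
    rw [← hom_mul hE, ← map_mul, inv_mul_cancel, map_one, hom_one hE]
  rwa [h2] at h1

theorem isContinuousInverseLimitAction_toContStarAut [TopologicalSpace G] (hE : IsFull A E)
    (hu : IsContinuousInverseLimitAction.{w, v, x} u) :
    ContStarAut.IsContinuousInverseLimitAction ((toContStarAut hE).comp u) := by
  have h := hasCofinalInvariantSeminorms hE hu.2
  refine ⟨h.isContinuousAction hE ?_, h.isInverseLimitAction, h⟩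
  rintro _ ⟨x, rfl⟩
  have h1 : Continuous fun g => inner A ((u g).1 x.1) ((u g).1 x.2) :=
    continuous_iff_continuousAt.2 fun g =>
      tendsto_inner A ((hu.1 x.1).tendsto g) ((hu.1 x.2).tendsto g)
  exact h1.congr fun g => (hom_inner (u g) x.1 x.2).symm

/-! ### The induced action on `K(E)` -/

section CompactOperators

attribute [local instance] Compact.nonUnitalRing Compact.starRing Compact.module Compact.smul

theorem eq_toContStarAutCompact {β : G →* ContStarAut (Compact A E)}
    (hβ : ∀ (g : G) (ξ η : E), (β g).1 (theta A ξ η) = theta A ((u g).1 ξ) ((u g).1 η)) :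
    β = (toContStarAutCompact A E).comp u := by
  have := Compact.t2Space A E
  refine MonoidHom.ext fun g => ContStarAut.ext_of_dense_span (Compact.dense_span_theta A E) ?_
  rintro _ ⟨x, rfl⟩
  exact (hβ g x.1 x.2).trans (toContStarAutCompact_theta (u g) x.1 x.2).symm

theorem opNorm_conj_le {p : ContCStarSeminorm A} {v : HilbertAut A E}
    (h : ∀ ξ : E, bar p (v.1 ξ) = bar p ξ) {T : Adjointable A E} (hT : T ∈ Compact A E) :
    Adjointable.opNorm p (conj v T) ≤ Adjointable.opNorm p T :=
  Adjointable.opNorm_le (Adjointable.opNorm_nonneg p T) fun ξ => by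
    rw [conj_apply, h]
    refine (Adjointable.bar_apply_le_opNorm p hT _).trans (le_of_eq ?_)
    rw [← h, apply_inv_apply]

theorem seminorm_conjCompact {p : ContCStarSeminorm A} {v : HilbertAut A E}
    (h : ∀ ξ : E, bar p (v.1 ξ) = bar p ξ) (T : Compact A E) :
    Compact.seminorm p (conjCompact v T) = Compact.seminorm p T := by
  refine le_antisymm (opNorm_conj_le h T.2) ?_
  have h' : ∀ ξ : E, bar p ((v⁻¹).1 ξ) = bar p ξ := fun ξ => by rw [← h, apply_inv_apply]
  have h1 := opNorm_conj_le h' (conj_mem_compact v T.2)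
  rwa [← conj_conj, inv_mul_cancel, conj_one] at h1

/-- Continuity gives `q < 1` on the ball of some `F` and `ε`. If `p` dominates `F`, this ball
contains all compact `T` with `opNorm p T < ε`, and the constant is removed by `le_of_forall_lt`. -/
theorem exists_finset_le_seminorm (q : ContCStarSeminorm (Compact A E)) :
    ∃ F : Finset (ContCStarSeminorm A), ∀ p, (∀ r ∈ F, r ≤ p) → q ≤ Compact.seminorm p := by
  have hq : ∀ᶠ T in 𝓝 (0 : Compact A E), q T < 1 := q.tendsto_zero.eventually_lt_const one_pos
  obtain ⟨⟨F, ε⟩, hε, hF⟩ := Compact.nhds_zero_hasBasis.eventually_iff.1 hq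
  refine ⟨F, fun p hp => ContCStarSeminorm.le_of_forall_lt hε fun T hT => ?_⟩
  rw [Compact.seminorm_apply] at hT
  have h1 : T.1 ∈ Adjointable.ball F ε := Adjointable.mem_ball_of_opNorm_le hp T.2 hT.le
  exact hF h1

/-- An invariant `p` can be taken above any finite set of seminorms. Its invariance on `A` passes to
`E` because `bar p (u ξ) ^ 2` is `p` of the image of `⟨ξ, ξ⟩` under the induced automorphism. -/
theorem exists_invariant_le_seminorm (hE : IsFull A E)
    (h : ContStarAut.HasCofinalInvariantSeminorms ((toContStarAut hE).comp u))
    (q : ContCStarSeminorm (Compact A E)) :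
    ∃ p : ContCStarSeminorm A, (∀ (g : G) (ξ : E), bar p ((u g).1 ξ) = bar p ξ) ∧
      q ≤ Compact.seminorm p := by
  obtain ⟨F, hF⟩ := exists_finset_le_seminorm q
  obtain ⟨p, hp, hFp⟩ := h.exists_forall_mem_le F
  refine ⟨p, fun g ξ => ?_, hF p hFp⟩
  rw [bar, bar, ← toContStarAut_inner hE]
  exact congrArg Real.sqrt (hp g _)

theorem hasCofinalInvariantSeminorms_compact (hE : IsFull A E)
    (h : ContStarAut.HasCofinalInvariantSeminorms ((toContStarAut hE).comp u)) :
    ContStarAut.HasCofinalInvariantSeminorms ((toContStarAutCompact A E).comp u) := fun q =>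
  (exists_invariant_le_seminorm hE h q).elim fun p hp =>
    ⟨Compact.seminorm p, fun g T => seminorm_conjCompact (hp.1 g) T, hp.2⟩

theorem isContinuousInverseLimitAction_toContStarAutCompact [TopologicalSpace G]
    (hE : IsFull A E) (hu : IsContinuousInverseLimitAction.{w, v, x} u) :
    ContStarAut.IsContinuousInverseLimitAction ((toContStarAutCompact A E).comp u) := by
  have h := hasCofinalInvariantSeminorms_compact hE (hasCofinalInvariantSeminorms hE hu.2)
  let _ := Compact.uniformSpace A E
  have := Compact.isLocallyCStarAlgebra A E
  refine ⟨h.isContinuousAction (Compact.dense_span_theta A E) ?_, h.isInverseLimitAction, h⟩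
  rintro _ ⟨x, rfl⟩
  have h1 : Continuous fun g => theta A ((u g).1 x.1) ((u g).1 x.2) :=
    continuous_iff_continuousAt.2 fun g =>
      Compact.tendsto_theta ((hu.1 x.1).tendsto g) ((hu.1 x.2).tendsto g)
  exact h1.congr fun g => (toContStarAutCompact_theta (u g) x.1 x.2).symm

end CompactOperators

end HilbertAut

theorem proposition3p8 {G : Type*} [Group G] [TopologicalSpace G]
    [IsTopologicalGroup G] [LocallyCompactSpace G]
    {A : Type*} [NonUnitalRing A] [StarRing A] [Module ℂ A] [UniformSpace A]
    [IsLocallyCStarAlgebra A]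
    {E : Type*} [AddCommGroup E] [Module ℂ E] [UniformSpace E] [HilbertModule A E]
    (hE : HilbertModule.IsFull A E) (u : G →* HilbertAut A E) :
    -- the induced action on `A`
    (∃! α : G →* ContStarAut A,
      ∀ (g : G) (ξ η : E), (α g).1 (inner A ξ η) = inner A ((u g).1 ξ) ((u g).1 η)) ∧
    -- the induced action on `K(E)`
    (∃! β : G →* ContStarAut (HilbertModule.Compact A E),
      ∀ (g : G) (ξ η : E), (β g).1 (HilbertModule.theta A ξ η) =
        HilbertModule.theta A ((u g).1 ξ) ((u g).1 η)) ∧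
    -- if `u` is a continuous inverse limit action, then so are the induced actions
    (HilbertAut.IsContinuousInverseLimitAction.{w, v, x} u →
      (∀ α : G →* ContStarAut A,
        (∀ (g : G) (ξ η : E), (α g).1 (inner A ξ η) = inner A ((u g).1 ξ) ((u g).1 η)) →
        ContStarAut.IsContinuousInverseLimitAction α) ∧
      (∀ β : G →* ContStarAut (HilbertModule.Compact A E),
        (∀ (g : G) (ξ η : E), (β g).1 (HilbertModule.theta A ξ η) =
          HilbertModule.theta A ((u g).1 ξ) ((u g).1 η)) →
        ContStarAut.IsContinuousInverseLimitAction β)) := by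
  refine ⟨⟨(HilbertAut.toContStarAut hE).comp u,
    fun g => HilbertAut.toContStarAut_inner hE (u g), fun α hα => HilbertAut.eq_toContStarAut hE hα⟩,
    ⟨(HilbertAut.toContStarAutCompact A E).comp u,
      fun g => HilbertAut.toContStarAutCompact_theta (u g),
      fun β hβ => HilbertAut.eq_toContStarAutCompact hβ⟩,
    fun hu => ⟨fun α hα => ?_, fun β hβ => ?_⟩⟩
  -- By uniqueness only the constructed action has to be considered.
  · rw [HilbertAut.eq_toContStarAut hE hα]
    exact HilbertAut.isContinuousInverseLimitAction_toContStarAut hE hu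
  · rw [HilbertAut.eq_toContStarAutCompact hβ]
    exact HilbertAut.isContinuousInverseLimitAction_toContStarAutCompact hE hu
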